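/- For integers $a\ge 0$ and $L\ge 1$ let $$\chi_{a,L}=\sum_{\substack{0\le i_1,\dots,i_L\le a\\ i_1+\cdots+i_L=a}} |i_1,\dots,i_L\rangle\in(\mathbb{C}^{a+1})^{\otimes L}$$ be the (unnormalized) weight state. Let $C_L$ be the cycle on $L$ vertices and let $\Omega_D\in(\mathbb{C}^D\otimes\mathbb{C}^D)^{\otimes L}$ be the product, over the $L$ edges of $C_L$, of the maximally entangled states $\sum_{b=1}^{D}|b\rangle\otimes|b\rangle$, where each vertex holds one tensor factor for each of the two edges meeting there. Let $$\mathrm{TNS}_{D,d}=\{A^{\otimes L}\,\Omega_D \;:\; A:\mathbb{C}^D\otimes\mathbb{C}^D\to\mathbb{C}^d \text{ linear}\}$$ be the set of translation-invariant tensor network states of bond dimension $D$. For $\psi\in(\mathbb{C}^d)^{\otimes L}$ let $\mathrm{bond}(\psi)$ be the least $D$ with $\psi\in\mathrm{TNS}_{D,d}$, and let $\underline{\mathrm{bond}}(\psi)$ be the least $D$ with $\psi\in\overline{\mathrm{TNS}_{D,d}}$ (either is $\infty$ if no such $D$ exists). Then, for all $a\ge 0$ and $L\ge 1$, $$\mathrm{bond}(\chi_{a,L})\le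 (a+1)L \qquad\text{and}\qquad \underline{\mathrm{bond}}(\chi_{a,L})\le a+1 ;$$ moreover, there are a local map $A(\epsilon):\mathbb{C}^{a+1}\otimes\mathbb{C}^{a+1}\to\mathbb{C}^{a+1}$ depending polynomially on $\epsilon$ and an integer $e\ge 0$ with $\chi_{a,L}=\lim_{\epsilon\to 0}\epsilon^{-e}A(\epsilon)^{\otimes L}\Omega_{a+1}$. Furthermore, $\mathrm{bond}(\chi_{a,L})=\Omega\big(L^{1/3}/\log L\big)$ for $a\ge 1$: there is an absolute constant $c>0$ such that, for all $a\ge 1$ and $L\ge 2$, $$\mathrm{bond}(\chi_{a,L})\ \ge\ c\,\frac{L^{1/3}}{\log L}.$$ -/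

import Mathlib

open Filter Topology Polynomial

noncomputable section

namespace TIMPS

/-- The space `(ℂ^ι)^{⊗ L}`: a vector is given by its coefficients in the product basis
`|i₀, …, i_{L-1}⟩`; it carries the usual topology of a finite-dimensional complex space. -/
abbrev State (L : ℕ) (ι : Type) : Type := (Fin L → ι) → ℂ

/-- The (unnormalized) weight state of weight `a` on `L` sites of local dimension `m + 1`: the sum
of all `|i₀, …, i_{L-1}⟩` with `0 ≤ i_k ≤ m` and `i₀ + ⋯ + i_{L-1} = a`. -/
def weightStateDim (a m L : ℕ) : State L (Fin (m + 1)) :=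
  fun i => if ∑ k, (i k : ℕ) = a then 1 else 0

/-- The weight state `χ_{a,L} ∈ (ℂ^{a+1})^{⊗ L}`. -/
def weightState (a L : ℕ) : State L (Fin (a + 1)) := weightStateDim a a L

/-- The state `Ω_D` of the cycle on `L` vertices: an (unnormalized) maximally entangled pair
`∑_b |b⟩ ⊗ |b⟩` on each edge `{k, k+1}`, indices mod `L`. Site `k` holds `ℂ^D ⊗ ℂ^D`, the first
factor for the edge from `k - 1` and the second for the edge to `k + 1`. -/
def cycleState (L D : ℕ) : State L (Fin D × Fin D) :=
  fun p => ∏ k, if (p k).2 = (p (finRotate L k)).1 then 1 else 0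

/-- The action of `A^{⊗ L}` on `(ℂ^κ)^{⊗ L}`, for a linear map `A : ℂ^κ → ℂ^ι` given by its
matrix. -/
def applyLocal {ι κ : Type} [Fintype κ] {L : ℕ} (A : Matrix ι κ ℂ) (ψ : State L κ) : State L ι :=
  fun i => ∑ p : Fin L → κ, (∏ k, A (i k) (p k)) * ψ p

/-- The translation-invariant tensor network state (matrix product state) on the cycle given by
the local map `A : ℂ^D ⊗ ℂ^D → ℂ^d`, used at every site. -/
def tiState {d D : ℕ} (L : ℕ) (A : Matrix (Fin d) (Fin D × Fin D) ℂ) : State L (Fin d) :=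
  applyLocal A (cycleState L D)

/-- The set of translation-invariant tensor network states of bond dimension `D` and local
dimension `d` on the cycle on `L` vertices. -/
def tiTNS (L D d : ℕ) : Set (State L (Fin d)) :=
  Set.range (fun A : Matrix (Fin d) (Fin D × Fin D) ℂ => tiState L A)

/-- The translation-invariant bond dimension: the least `D` with `ψ ∈ tiTNS L D d`
(`⊤` if there is none). -/
def tiBond {L d : ℕ} (ψ : State L (Fin d)) : ℕ∞ :=
  ⨅ (D : ℕ) (_ : ψ ∈ tiTNS L D d), (D : ℕ∞)

/-- The translation-invariant border bond dimension: the least `D` such that `ψ` lies in the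
closure of `tiTNS L D d` (`⊤` if there is none). -/
def tiBorderBond {L d : ℕ} (ψ : State L (Fin d)) : ℕ∞ :=
  ⨅ (D : ℕ) (_ : ψ ∈ closure (tiTNS L D d)), (D : ℕ∞)

/-- `ψ` has a translation-invariant border representation of bond dimension `D`: there are a local
map `A(ε)` depending polynomially on `ε` and a nonnegative integer `e` with
`ψ = lim_{ε → 0} ε^{-e} A(ε)^{⊗ L} Ω_D`. -/
def HasTIBorderRepresentation {L d : ℕ} (D : ℕ) (ψ : State L (Fin d)) : Prop :=
  ∃ (A : Matrix (Fin d) (Fin D × Fin D) ℂ[X]) (e : ℕ),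
    Tendsto (fun ε : ℂ => (ε ^ e)⁻¹ • tiState L (A.map (Polynomial.eval ε))) (𝓝[≠] 0) (𝓝 ψ)

end TIMPS

end

/-!
By `tiState_apply_eq_trace`, a translation-invariant tensor network state on a cycle has as its
coefficients the traces of products of `D × D` matrices, one matrix for each basis vector of the
physical space.

For the upper bounds, diagonal matrices made of `M`-th roots of unity give a state of bond
dimension `M` which is the indicator of the basis states of weight `a` modulo `M`
(`exists_tiState_eq_pow_mul_ite`). For `M = (a + 1) L` this is the weight state. For `M = a + 1` a
factor `ε ^ x` on the basis vector `x` suppresses the weights beyond `a`.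

For the lower bound, only the matrices `A` and `B` of the basis vectors `0` and `a` are used: the
trace of a word of length `L` with at least one `B` is `1` if `B` occurs once and `0` otherwise.
Such words are turned into products of elements of a subspace. Let `g` be the invertible matrix
which is `A` on the part where `A` is invertible and the identity on the nilpotent part, and let `Y`
be the span of the conjugates of the letter `P * B * C` by powers of `g`, where `P` is the Fitting
idempotent of `A` and `C` the inverse of `A` on the range of `P`. Any `D ^ 2` consecutive conjugates
span `Y` (`map_span_orbit_eq`), so the positions of the conjugates in a product may be chosen
increasing with large gaps, and `trace (g ^ L * ·)` of such a product is the trace of a word of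
length `L`, as long as the number of factors is at most of order `L / D ^ 2`. Thus the functional
`trace (g ^ L * ·)` vanishes on all products of at least two and at most `N` elements of `Y`, with
`N` of order `L / D ^ 2`, but not on `Y` itself (`lt_of_forall_trace_word`).

This is impossible once `N` is of order `D log D` (`trace_mul_eq_zero_of_forall_pow`). As `g`
normalises the algebra generated by `Y`, the functional kills the Jacobson radical of this algebra
and descends to the semisimple quotient, a product of matrix algebras of total degree at most `D`.
There, words of length `O(D log D)` span an element which has rank one on one relevant factor and
vanishes on the other relevant ones (`exists_mem_pow_eq_vecMulVec`); multiplying it on both sides by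
words of length `O(D)` containing letters of `Y`, a product of at least two letters is found on
which the functional does not vanish (`apply_eq_zero_of_forall_pow_of_pi_matrix`).

The short words come from a rank halving argument (`exists_mem_pow_two_mul_finrank_le`). Given an
operator `E` spanned by words of length `ℓ`, if `E w E` is a multiple of `E` for all words `w`, then
`E` has rank one on one factor and vanishes on the others. Otherwise take a shortest word `w` that
fails. Its suffixes, applied to suitable vectors, are linearly independent
(`length_add_one_mul_le_finrank`), which bounds the length of `w`, and a polynomial in `E w` gives
an operator of at most half the rank. Throughout, length times rank grows by at most `4 D` in each
of the at most `log D` steps.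

Altogether `L` is of order at most `D ^ 3 log D`.
-/

/-! ### Ranks of polynomials in one endomorphism -/

section Ranks

variable {K : Type*} [Field K] {R : Type*} [AddCommGroup R] [Module K R] [FiniteDimensional K R]

theorem finrank_range_mul_add_finrank_inf_ker (f g : Module.End K R) :
    Module.finrank K (LinearMap.range (f * g)) +
      Module.finrank K ↥(LinearMap.range g ⊓ LinearMap.ker f) =
      Module.finrank K (LinearMap.range g) := by
  have h := LinearMap.finrank_range_add_finrank_ker (f.domRestrict (LinearMap.range g))
  have h1 : LinearMap.range (f.domRestrict (LinearMap.range g)) = LinearMap.range (f * g) := by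
    rw [LinearMap.range_domRestrict, Module.End.mul_eq_comp, LinearMap.range_comp]
  have h2 : Module.finrank K (LinearMap.ker (f.domRestrict (LinearMap.range g))) =
      Module.finrank K ↥(LinearMap.range g ⊓ LinearMap.ker f) := by
    rw [LinearMap.ker_domRestrict]
    have := (Submodule.equivSubtypeMap (LinearMap.range g)
      ((LinearMap.ker f).comap (LinearMap.range g).subtype)).finrank_eq
    rw [Submodule.map_comap_subtype] at this
    exact this
  rw [h1, h2] at h
  exact h

variable [IsAlgClosed K]

/-- Cancelling a suitable linear factor `X - μ` from the minimal polynomial of `b` leaves a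
polynomial `q` such that the rank of `q(b)` is at most the dimension divided by the degree of the
minimal polynomial. -/
theorem exists_minpoly_eq_mul_and_natDegree_mul_finrank_le [Nontrivial R] (b : Module.End K R) :
    ∃ (μ : K) (q : K[X]), minpoly K b = q * (X - C μ) ∧
      (minpoly K b).natDegree * Module.finrank K (LinearMap.range (aeval b q)) ≤
        Module.finrank K R := by
  classical
  have hint : IsIntegral K b := Algebra.IsIntegral.isIntegral b
  have hp0 := minpoly.ne_zero hint
  have hdeg : (minpoly K b).degree ≠ 0 := (minpoly.degree_pos hint).ne'
  let Pr : ℕ → Prop := fun ρ => ∃ (μ : K) (q : K[X]), minpoly K b = q * (X - C μ) ∧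
    Module.finrank K (LinearMap.range (aeval b q)) = ρ
  have hex : ∃ ρ, Pr ρ := by
    obtain ⟨μ, hμ⟩ := IsAlgClosed.exists_root _ hdeg
    obtain ⟨q, hq⟩ := dvd_iff_isRoot.mpr hμ
    exact ⟨_, μ, q, by rw [hq, mul_comm], rfl⟩
  obtain ⟨μ, q, hq, hρ⟩ := Nat.find_spec hex
  set ρ := Nat.find hex
  have hmin : ∀ (μ : K) (q : K[X]), minpoly K b = q * (X - C μ) →
      ρ ≤ Module.finrank K (LinearMap.range (aeval b q)) := fun μ q h =>
    Nat.find_min' hex ⟨μ, q, h, rfl⟩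
  -- peeling off the linear factors of the minimal polynomial one at a time, each lowers the rank
  -- by at least `ρ`
  have key : ∀ (k : ℕ) (s : K[X]), s.natDegree = k → s ∣ minpoly K b →
      Module.finrank K (LinearMap.range (aeval b s)) + k * ρ ≤ Module.finrank K R := by
    intro k
    induction k with
    | zero =>
      intro s _ _
      simpa using Submodule.finrank_le _
    | succ k ih =>
      intro s hs hsd
      have hs0 : s.degree ≠ 0 := by
        intro h
        rw [natDegree_eq_zero_iff_degree_le_zero.mpr h.le] at hs
        omega
      obtain ⟨ν, hν⟩ := IsAlgClosed.exists_root _ hs0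
      obtain ⟨s₁, rfl⟩ := dvd_iff_isRoot.mpr hν
      obtain ⟨u, hu⟩ := hsd
      have hs1 : s₁ ≠ 0 := by rintro rfl; simp at hs
      have hd1 : s₁.natDegree = k := by
        rw [natDegree_mul (X_sub_C_ne_zero ν) hs1, natDegree_X_sub_C] at hs
        omega
      have h1 := ih s₁ hd1 (hu ▸ Dvd.intro_left ((X - C ν) * u) (by ring))
      have h2 := hmin ν (s₁ * u) (by rw [hu]; ring)
      have h3 := finrank_range_mul_add_finrank_inf_ker (aeval b (X - C ν)) (aeval b s₁)
      have h4 : LinearMap.range (aeval b (s₁ * u)) ≤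
          LinearMap.range (aeval b s₁) ⊓ LinearMap.ker (aeval b (X - C ν)) := by
        rintro _ ⟨x, rfl⟩
        refine ⟨⟨aeval b u x, by rw [map_mul]; rfl⟩, ?_⟩
        have : aeval b ((X - C ν) * (s₁ * u)) = 0 := by
          rw [← mul_assoc, ← hu, minpoly.aeval]
        rw [map_mul] at this
        exact LinearMap.congr_fun this x
      have h5 := Submodule.finrank_mono h4
      rw [← map_mul] at h3
      rw [Nat.add_mul]
      omega
  have := key _ (minpoly K b) rfl dvd_rfl
  exact ⟨μ, q, hq, by rw [hρ]; omega⟩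

/-- If no shift `b - μ` has its range inside a subspace as small as `P`, then `P` can be enlarged
by a vector `x` together with `b x`, gaining two dimensions. -/
theorem exists_notMem_and_apply_notMem_sup_span (b : Module.End K R) {t : ℕ}
    (ht : ∀ μ : K, t ≤ Module.finrank K (LinearMap.range (b - algebraMap K _ μ)))
    (P : Submodule K R) (hP : Module.finrank K P < t) :
    ∃ x, x ∉ P ∧ b x ∉ P ⊔ Submodule.span K {x} := by
  by_contra! hcon
  -- an eigenvalue shows that `t` is less than the dimension, so `P` has codimension at least two
  have hlt : t < Module.finrank K R := by
    have : Nontrivial R := by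
      by_contra hn
      rw [not_nontrivial_iff_subsingleton] at hn
      have := ht 0
      rw [Module.finrank_zero_of_subsingleton] at this
      omega
    obtain ⟨μ, hμ⟩ := Module.End.exists_eigenvalue b
    obtain ⟨v, hv⟩ := hμ.exists_hasEigenvector
    refine lt_of_le_of_lt (ht μ) ?_
    have h1 := LinearMap.finrank_range_add_finrank_ker (b - algebraMap K _ μ)
    have h2 : 0 < Module.finrank K (LinearMap.ker (b - algebraMap K (Module.End K R) μ)) := by
      rw [Module.finrank_pos_iff_exists_ne_zero]
      refine ⟨⟨v, ?_⟩, fun h => hv.2 (congrArg Subtype.val h)⟩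
      simp [hv.apply_eq_smul]
    omega
  -- `P` is stable under `b`, and every vector of the quotient is an eigenvector
  have hstab : ∀ p ∈ P, b p ∈ P := by
    intro p hp
    by_contra hbp
    have hne : P ⊔ Submodule.span K {b p} ≠ ⊤ := by
      intro h
      have h1 := Submodule.finrank_add_le_finrank_add_finrank P (Submodule.span K {b p})
      have h2 := finrank_span_singleton (K := K) (v := b p) (fun h0 => hbp (h0 ▸ P.zero_mem))
      rw [h, finrank_top] at h1
      omega
    obtain ⟨y, -, hy⟩ := SetLike.exists_of_lt (lt_top_iff_ne_top.mpr hne)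
    have hyP : y ∉ P := fun h => hy (Submodule.mem_sup_left h)
    have hypP : y + p ∉ P := fun h => hyP (by simpa using P.sub_mem h hp)
    obtain ⟨q, hq, z, hz, h1⟩ := Submodule.mem_sup.mp (hcon y hyP)
    obtain ⟨c, rfl⟩ := Submodule.mem_span_singleton.mp hz
    obtain ⟨q', hq', z', hz', h2⟩ := Submodule.mem_sup.mp (hcon _ hypP)
    obtain ⟨c', rfl⟩ := Submodule.mem_span_singleton.mp hz'
    have h3 : b p = (q' - q + c' • p) + (c' - c) • y := by
      rw [map_add, ← h1] at h2
      have : b p = q' + c' • (y + p) - (q + c • y) := by rw [h2]; abel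
      rw [this]
      module
    have hqq : q' - q + c' • p ∈ P := P.add_mem (P.sub_mem hq' hq) (P.smul_mem _ hp)
    have hc : c' - c ≠ 0 := by
      intro h0
      rw [h0, zero_smul, add_zero] at h3
      exact hbp (h3 ▸ hqq)
    apply hy
    have h4 : y = (c' - c)⁻¹ • (b p - (q' - q + c' • p)) := by
      rw [h3, add_sub_cancel_left, smul_smul, inv_mul_cancel₀ hc, one_smul]
    rw [h4]
    exact Submodule.smul_mem _ _ (Submodule.sub_mem _
      (Submodule.mem_sup_right (Submodule.mem_span_singleton_self _)) (Submodule.mem_sup_left hqq))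
  obtain ⟨c, hc⟩ : ∃ c : K, P.mapQ P b hstab = c • LinearMap.id := by
    apply LinearMap.exists_eq_smul_id_of_forall_notLinearIndependent
    intro v
    obtain ⟨x, rfl⟩ := P.mkQ_surjective v
    by_cases hx : x ∈ P
    · have : P.mkQ x = 0 := by simpa using hx
      rw [this]
      exact fun h => h.ne_zero 0 (by simp)
    · obtain ⟨q, hq, z, hz, h1⟩ := Submodule.mem_sup.mp (hcon x hx)
      obtain ⟨c, rfl⟩ := Submodule.mem_span_singleton.mp hz
      have h2 : P.mapQ P b hstab (P.mkQ x) = c • P.mkQ x := by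
        rw [Submodule.mkQ_apply, Submodule.mapQ_apply, ← h1]
        simp [(Submodule.Quotient.mk_eq_zero P).mpr hq]
      rw [h2]
      intro h
      have := LinearIndependent.pair_iff.mp h (-c) 1 (by simp)
      simp at this
  have hr : LinearMap.range (b - algebraMap K _ c) ≤ P := by
    rintro _ ⟨x, rfl⟩
    have := LinearMap.congr_fun hc (P.mkQ x)
    rw [Submodule.mkQ_apply, Submodule.mapQ_apply] at this
    rw [← Submodule.Quotient.mk_eq_zero P]
    simp [this]
  have h1 := Submodule.finrank_mono hr
  have h2 := ht c
  omega

/-- If all shifts `b - μ` have rank at least `t`, about half of `t` vectors can be chosen which are,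
together with their images under `b`, linearly independent. -/
theorem exists_linearIndependent_sumElim_apply (b : Module.End K R) {t : ℕ}
    (ht : ∀ μ : K, t ≤ Module.finrank K (LinearMap.range (b - algebraMap K _ μ)))
    (k : ℕ) (hk : 2 * k ≤ t + 1) :
    ∃ x : Fin k → R, LinearIndependent K (Sum.elim x (fun a => b (x a))) := by
  have key : ∃ x : Fin k → R, 2 * k ≤ Module.finrank K
      (Submodule.span K (Set.range x ∪ Set.range fun a => b (x a))) := by
    induction k with
    | zero => exact ⟨Fin.elim0, by simp⟩
    | succ k ih =>
      obtain ⟨x, hx⟩ := ih (by omega)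
      set P := Submodule.span K (Set.range x ∪ Set.range fun a => b (x a)) with hPdef
      by_cases hP : Module.finrank K P < t
      · obtain ⟨y, hy, hby⟩ := exists_notMem_and_apply_notMem_sup_span b ht P hP
        refine ⟨Fin.cons y x, ?_⟩
        set P' := Submodule.span K
          (Set.range (Fin.cons y x : Fin (k + 1) → R) ∪
            Set.range fun a => b ((Fin.cons y x : Fin (k + 1) → R) a)) with hP'
        have hmem : ∀ a, (Fin.cons y x : Fin (k + 1) → R) a ∈ P' ∧
            b ((Fin.cons y x : Fin (k + 1) → R) a) ∈ P' := fun a =>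
          ⟨Submodule.subset_span (Or.inl ⟨a, rfl⟩), Submodule.subset_span (Or.inr ⟨a, rfl⟩)⟩
        have hPP' : P ≤ P' := by
          rw [hPdef, Submodule.span_le]
          rintro _ (⟨a, rfl⟩ | ⟨a, rfl⟩)
          · exact (hmem a.succ).1
          · exact (hmem a.succ).2
        have h1 : P < P ⊔ Submodule.span K {y} := lt_of_le_of_ne le_sup_left fun h => hy
          (h ▸ Submodule.mem_sup_right (Submodule.mem_span_singleton_self y))
        have h2 : P ⊔ Submodule.span K {y} < P' := by
          refine lt_of_le_of_ne (sup_le hPP' ?_) fun h => hby (h ▸ (hmem 0).2)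
          rw [Submodule.span_singleton_le_iff_mem]
          exact (hmem 0).1
        have h3 := Submodule.finrank_lt_finrank_of_lt h1
        have h4 := Submodule.finrank_lt_finrank_of_lt h2
        omega
      · exfalso
        have : Module.finrank K P ≤ Fintype.card (Fin k ⊕ Fin k) := by
          rw [hPdef, ← Set.Sum.elim_range]
          exact finrank_range_le_card _
        simp at this
        omega
  obtain ⟨x, hx⟩ := key
  refine ⟨x, linearIndependent_iff_card_le_finrank_span.mpr ?_⟩
  rw [Set.finrank, Set.Sum.elim_range]
  simpa [two_mul] using hx

end Ranks

/-! ### Suffixes of a shortest word -/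

section Suffixes

variable {K : Type*} [Field K]

theorem Submodule.pow_eq_span_list_prod {A : Type*} [Ring A] [Algebra K A] (S : Submodule K A)
    (n : ℕ) :
    S ^ n = Submodule.span K {a | ∃ l : List A, l.length = n ∧ (∀ y ∈ l, y ∈ S) ∧ l.prod = a} := by
  rw [Submodule.pow_eq_span_pow_set]
  congr 1
  ext a
  rw [Set.mem_pow]
  constructor
  · rintro ⟨f, rfl⟩
    refine ⟨List.ofFn fun i => (f i : A), by simp, ?_, rfl⟩
    intro y hy
    obtain ⟨i, rfl⟩ := List.mem_ofFn.mp hy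
    exact (f i).2
  · rintro ⟨l, rfl, hl, rfl⟩
    exact ⟨fun i => ⟨l.get i, hl _ (l.get_mem i)⟩, by simp⟩

theorem Submodule.list_prod_mem_pow {A : Type*} [Ring A] [Algebra K A] {S : Submodule K A}
    {l : List A} (hl : ∀ y ∈ l, y ∈ S) : l.prod ∈ S ^ l.length := by
  rw [Submodule.pow_eq_span_list_prod]
  exact Submodule.subset_span ⟨l, rfl, hl, rfl⟩

variable {V : Type*} [AddCommGroup V] [Module K V] [FiniteDimensional K V]

/-- If `l` is a word such that deleting any nonempty block of consecutive letters turns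
`E * l.prod * E` into a multiple of `E`, and the vectors `E uₐ`, `E * l.prod * E uₐ` are linearly
independent, then the images of the `E uₐ` under the `l.length + 1` suffixes of `l` are linearly
independent. -/
theorem length_add_one_mul_le_finrank (E : Module.End K V) (l : List (Module.End K V)) (k : ℕ)
    (u : Fin k → V)
    (hu : LinearIndependent K (Sum.elim (fun a => E (u a)) (fun a => (E * l.prod * E) (u a))))
    (hl : ∀ i j, i < j → j ≤ l.length →
      E * ((l.take i).prod * (l.drop j).prod) * E ∈ Submodule.span K {E}) :
    (l.length + 1) * k ≤ Module.finrank K V := by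
  have hli : LinearIndependent K
      (fun p : Fin (l.length + 1) × Fin k => ((l.drop p.1).prod * E) (u p.2)) := by
    rw [Fintype.linearIndependent_iff]
    intro c hc
    rw [Fintype.linearIndependent_iff] at hu
    -- the coefficients of the suffixes longer than `l.drop i` vanish by induction, and applying `E`
    -- times the prefix `l.take i` sends the shorter ones to multiples of the `E uₐ`
    have key : ∀ i : ℕ, ∀ hi : i < l.length + 1, ∀ a, c (⟨i, hi⟩, a) = 0 := by
      intro i
      induction i using Nat.strong_induction_on with
      | _ i ih =>
      intro hi
      have hscal : ∀ j : Fin (l.length + 1), ∃ s : K, i < j →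
          E * ((l.take i).prod * (l.drop j).prod) * E = s • E := by
        intro j
        by_cases hj : i < j
        · obtain ⟨s, hs⟩ := Submodule.mem_span_singleton.mp (hl i j hj (by omega))
          exact ⟨s, fun _ => hs.symm⟩
        · exact ⟨0, fun h => absurd h hj⟩
      choose s hs using hscal
      have h1 := congrArg (E * (l.take i).prod) hc
      rw [map_sum, map_zero, Fintype.sum_prod_type] at h1
      have h2 : ∀ j : Fin (l.length + 1), ∀ a : Fin k,
          (E * (l.take i).prod) (c (j, a) • ((l.drop j).prod * E) (u a)) =
          (if j = ⟨i, hi⟩ then c (⟨i, hi⟩, a) else 0) • (E * l.prod * E) (u a) +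
          (if i < j then c (j, a) * s j else 0) • E (u a) := by
        intro j a
        rw [map_smul]
        rcases lt_trichotomy (j : ℕ) i with hj | hj | hj
        · rw [ih j hj j.2 a]
          have : j ≠ ⟨i, hi⟩ := fun h => by rw [h] at hj; simp at hj
          simp [this]
        · have hj' : j = ⟨i, hi⟩ := Fin.ext hj
          subst hj'
          simp only [if_true, lt_irrefl, if_false, zero_smul, add_zero]
          rw [← Module.End.mul_apply, ← List.prod_take_mul_prod_drop l i]
          simp only [mul_assoc]
        · have : j ≠ ⟨i, hi⟩ := fun h => by rw [h] at hj; simp at hj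
          simp only [this, hj, if_true, if_false, zero_smul, zero_add]
          rw [← Module.End.mul_apply, mul_smul]
          have h3 := hs j hj
          rw [← LinearMap.smul_apply (s j) E, ← h3]
          simp only [mul_assoc]
      simp only [h2, Finset.sum_add_distrib] at h1
      rw [Finset.sum_comm] at h1
      rw [Finset.sum_comm (s := Finset.univ) (t := Finset.univ)
        (f := fun (j : Fin (l.length + 1)) (a : Fin k) =>
          (if i < (j : ℕ) then c (j, a) * s j else 0) • E (u a))] at h1
      simp only [← Finset.sum_smul, Finset.sum_ite_eq', Finset.mem_univ, if_true] at h1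
      have h4 := hu (Sum.elim
        (fun a => ∑ j : Fin (l.length + 1), if i < (j : ℕ) then c (j, a) * s j else 0)
        (fun a => c (⟨i, hi⟩, a))) (by
          rw [Fintype.sum_sum_type]
          simp only [Sum.elim_inl, Sum.elim_inr]
          rw [add_comm]
          exact h1)
      intro a
      exact h4 (Sum.inr a)
    rintro ⟨⟨i, hi⟩, a⟩
    exact key i hi a
  have := hli.fintype_card_le_finrank
  simpa using this

end Suffixes

/-! ### Short operators `E` with `E w E` a multiple of `E` -/

section ShortWords

variable {K : Type*} [Field K] {V : Type*} [AddCommGroup V] [Module K V]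

theorem Submodule.pow_mono_of_one_mem {A : Type*} [Ring A] [Algebra K A] {S : Submodule K A}
    (h1 : (1 : A) ∈ S) {m n : ℕ} (h : m ≤ n) : S ^ m ≤ S ^ n :=
  pow_le_pow_right₀ (Submodule.one_le.mpr h1) h

theorem exists_list_mul_prod_mul_notMem {S : Submodule K (Module.End K V)} {E : Module.End K V}
    {m : ℕ} (h : ∃ w ∈ S ^ m, E * w * E ∉ Submodule.span K {E}) :
    ∃ l : List (Module.End K V), l.length = m ∧ (∀ y ∈ l, y ∈ S) ∧
      E * l.prod * E ∉ Submodule.span K {E} := by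
  by_contra! hcon
  obtain ⟨w, hw, hwE⟩ := h
  have : S ^ m ≤ (Submodule.span K {E}).comap
      (LinearMap.mulRight K E ∘ₗ LinearMap.mulLeft K E) := by
    rw [Submodule.pow_eq_span_list_prod, Submodule.span_le]
    rintro _ ⟨l, hl, hlS, rfl⟩
    exact hcon l hl hlS
  exact hwE (this hw)

/-- The compression of `E * w` to the range of `E`. -/
def rangeCompression (E w : Module.End K V) : Module.End K (LinearMap.range E) :=
  (E * w).restrict (p := LinearMap.range E) (q := LinearMap.range E) fun x _ => ⟨w x, rfl⟩

theorem coe_rangeCompression_apply (E w : Module.End K V) (x : LinearMap.range E) :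
    (rangeCompression E w x : V) = (E * w) x := rfl

theorem coe_aeval_rangeCompression_apply (E w : Module.End K V) (q : K[X])
    (x : LinearMap.range E) :
    (aeval (rangeCompression E w) q x : V) = aeval (E * w) q (x : V) := by
  induction q using Polynomial.induction_on with
  | C a => simp
  | add p q hp hq => simp [hp, hq]
  | monomial n a h =>
    rw [pow_succ', mul_left_comm, map_mul, map_mul _ X, Module.End.mul_apply,
      Module.End.mul_apply _ _ (x : V), aeval_X, aeval_X, coe_rangeCompression_apply, h]

theorem finrank_range_aeval_rangeCompression (E w : Module.End K V) (q : K[X]) :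
    Module.finrank K (LinearMap.range (aeval (rangeCompression E w) q)) =
      Module.finrank K (LinearMap.range (aeval (E * w) q * E)) := by
  have h : aeval (E * w) q * E =
      (LinearMap.range E).subtype ∘ₗ aeval (rangeCompression E w) q ∘ₗ E.rangeRestrict := by
    ext x
    simp [coe_aeval_rangeCompression_apply]
  rw [h, LinearMap.range_comp, LinearMap.range_comp, LinearMap.range_rangeRestrict,
    Submodule.map_top]
  exact (LinearEquiv.finrank_eq (Submodule.equivMapOfInjective _
    (Submodule.injective_subtype _) _))

theorem aeval_mul_mem_pow {S : Submodule K (Module.End K V)} (h1 : 1 ∈ S) {E w : Module.End K V}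
    {ℓ m : ℕ} (hE : E ∈ S ^ ℓ) (hw : w ∈ S ^ m) (q : K[X]) :
    aeval (E * w) q * E ∈ S ^ ((ℓ + m) * q.natDegree + ℓ) := by
  rw [aeval_eq_sum_range, Finset.sum_mul]
  refine Submodule.sum_mem _ fun i hi => ?_
  rw [smul_mul_assoc]
  refine Submodule.smul_mem _ _ ?_
  rw [pow_add, pow_mul]
  refine Submodule.mul_mem_mul ?_ hE
  have hi' : i ≤ q.natDegree := by simpa [Nat.lt_succ_iff] using hi
  have h2 : (1 : Module.End K V) ∈ S ^ (ℓ + m) :=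
    Submodule.pow_mono_of_one_mem h1 (Nat.zero_le _)
      (by rw [pow_zero]; exact Submodule.one_le.mp le_rfl)
  refine Submodule.pow_mono_of_one_mem h2 hi' (Submodule.pow_mem_pow _ ?_ _)
  rw [pow_add]
  exact Submodule.mul_mem_mul hE hw

variable [FiniteDimensional K V] [IsAlgClosed K]

/-- The halving step. If some `E w E` is not a multiple of `E`, there is a nonzero operator `E'` of
at most half the rank of `E`, again a combination of words, and length times rank grows by at most
`4 n`, where `n` is the dimension. A shortest such `w` is a word to which the suffix count applies,
so that its length is at most `2 n / t`, where `t` is the smallest rank of an operator `E w E - μ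
E`. If `2 t` is at most the rank of `E`, such an operator is the desired `E'`; otherwise a
polynomial in `E w`, times `E`, is. -/
theorem exists_mem_pow_two_mul_finrank_le {S : Submodule K (Module.End K V)} (h1 : 1 ∈ S)
    {ℓ : ℕ} {E : Module.End K V} (hE : E ∈ S ^ ℓ)
    (hex : ∃ p, ∃ w ∈ S ^ p, E * w * E ∉ Submodule.span K {E}) :
    ∃ (ℓ' : ℕ) (E' : Module.End K V), E' ∈ S ^ ℓ' ∧ E' ≠ 0 ∧
      2 * Module.finrank K (LinearMap.range E') ≤ Module.finrank K (LinearMap.range E) ∧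
      ℓ' * Module.finrank K (LinearMap.range E') ≤
        ℓ * Module.finrank K (LinearMap.range E) + 4 * Module.finrank K V := by
  classical
  obtain ⟨l, hlen, hlS, hlE⟩ := exists_list_mul_prod_mul_notMem (Nat.find_spec hex)
  have hmin : ∀ p, p < l.length → ∀ w ∈ S ^ p, E * w * E ∈ Submodule.span K {E} := by
    intro p hp w hw
    by_contra hcon
    exact Nat.find_min hex (hlen ▸ hp) ⟨w, hw, hcon⟩
  set w := l.prod with hwdef
  have hw : w ∈ S ^ l.length := Submodule.list_prod_mem_pow hlS
  set m := l.length with hm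
  set n := Module.finrank K V
  set r := Module.finrank K (LinearMap.range E) with hr
  set b := rangeCompression E w with hb
  have hrank : ∀ μ : K, Module.finrank K (LinearMap.range (b - algebraMap K _ μ)) =
      Module.finrank K (LinearMap.range (E * w * E - μ • E)) := by
    intro μ
    have := finrank_range_aeval_rangeCompression E w (X - C μ)
    rw [map_sub, map_sub, aeval_X, aeval_X, aeval_C, aeval_C, sub_mul, ← Algebra.smul_def] at this
    exact this
  have hexρ : ∃ ρ, ∃ μ : K, Module.finrank K (LinearMap.range (b - algebraMap K _ μ)) = ρ :=
    ⟨_, 0, rfl⟩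
  obtain ⟨μ₀, hμ₀⟩ := Nat.find_spec hexρ
  set t := Nat.find hexρ with ht
  have htmin : ∀ μ : K, t ≤ Module.finrank K (LinearMap.range (b - algebraMap K _ μ)) :=
    fun μ => Nat.find_min' hexρ ⟨μ, rfl⟩
  have hne : ∀ μ : K, E * w * E - μ • E ≠ 0 := fun μ h => hlE
    (Submodule.mem_span_singleton.mpr ⟨μ, (sub_eq_zero.mp h).symm⟩)
  have hpos : ∀ F : Module.End K V, F ≠ 0 → 0 < Module.finrank K (LinearMap.range F) := by
    intro F hF
    rw [Module.finrank_pos_iff, Submodule.nontrivial_iff_ne_bot]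
    exact fun h => hF (LinearMap.range_eq_bot.mp h)
  have ht0 : 0 < t := by
    rw [← hμ₀, hrank]
    exact hpos _ (hne μ₀)
  -- short words: the dimension count for the suffixes of `l`
  have hmt : m * t ≤ 2 * n := by
    obtain ⟨x, hx⟩ := exists_linearIndependent_sumElim_apply b htmin ((t + 1) / 2) (by omega)
    have hxu : ∀ a, ∃ u, E u = x a := fun a => (x a).2
    choose u hu using hxu
    have hli := hx.map' (LinearMap.range E).subtype (Submodule.ker_subtype _)
    have hfam : Sum.elim (fun a => E (u a)) (fun a => (E * l.prod * E) (u a)) =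
        (LinearMap.range E).subtype ∘ Sum.elim x fun a => b (x a) := by
      ext i
      rcases i with a | a
      · simp [hu]
      · simp only [Sum.elim_inr, Function.comp_apply, Submodule.subtype_apply,
          hb, coe_rangeCompression_apply, Module.End.mul_apply, hu]
        rfl
    have := length_add_one_mul_le_finrank E l ((t + 1) / 2) u (hfam ▸ hli) (by
      intro i j hij hj
      refine hmin (i + (l.length - j)) (by omega) _ ?_
      rw [pow_add]
      refine Submodule.mul_mem_mul ?_ ?_
      · have := Submodule.list_prod_mem_pow (S := S) (l := l.take i)
          fun y hy => hlS y (List.mem_of_mem_take hy)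
        rwa [List.length_take, min_eq_left (by omega)] at this
      · have := Submodule.list_prod_mem_pow (S := S) (l := l.drop j)
          fun y hy => hlS y (List.mem_of_mem_drop hy)
        rwa [List.length_drop] at this)
    have h2 : t ≤ 2 * ((t + 1) / 2) := by omega
    nlinarith
  by_cases h2t : 2 * t ≤ r
  · refine ⟨2 * ℓ + m, E * w * E - μ₀ • E, ?_, hne μ₀, ?_, ?_⟩
    · refine Submodule.sub_mem _ ?_ (Submodule.smul_mem _ _
        (Submodule.pow_mono_of_one_mem h1 (by omega) hE))
      rw [show 2 * ℓ + m = ℓ + m + ℓ by ring, pow_add, pow_add]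
      exact Submodule.mul_mem_mul (Submodule.mul_mem_mul hE hw) hE
    · rw [← hrank, hμ₀]
      exact h2t
    · rw [← hrank, hμ₀]
      nlinarith
  · -- now `t` is comparable to `r`, which bounds the length of the word in terms of `r`; since
    -- `b` is not a scalar, its minimal polynomial has degree at least two
    have hmr : m * r ≤ 4 * n := by nlinarith
    have : Nontrivial (LinearMap.range E) := by
      by_contra hn
      rw [not_nontrivial_iff_subsingleton] at hn
      have := Submodule.finrank_le (LinearMap.range (b - algebraMap K _ μ₀))
      rw [Module.finrank_zero_of_subsingleton (M := LinearMap.range E)] at this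
      omega
    obtain ⟨μ, q, hq, hle⟩ := exists_minpoly_eq_mul_and_natDegree_mul_finrank_le b
    have hint : IsIntegral K b := Algebra.IsIntegral.isIntegral b
    have hmin0 := minpoly.ne_zero hint
    have hq0 : q ≠ 0 := by
      rintro rfl
      simp at hq
      exact hmin0 hq
    have hdeg : (minpoly K b).natDegree = q.natDegree + 1 := by
      rw [hq, natDegree_mul hq0 (X_sub_C_ne_zero μ), natDegree_X_sub_C]
    have hdeg1 : 1 ≤ q.natDegree := by
      by_contra hcon
      have hqC := eq_C_of_natDegree_eq_zero (show q.natDegree = 0 by omega)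
      have h3 : aeval b (minpoly K b) = 0 := minpoly.aeval K b
      rw [hq, hqC, map_mul, aeval_C, ← Algebra.smul_def, map_sub, aeval_X, aeval_C] at h3
      have hc0 : q.coeff 0 ≠ 0 := fun h => hq0 (by rw [hqC, h, C_0])
      have h4 := (smul_eq_zero.mp h3).resolve_left hc0
      have h5 := htmin μ
      rw [h4, LinearMap.range_zero, finrank_bot] at h5
      omega
    have haq : aeval b q ≠ 0 := by
      intro h
      have := natDegree_le_natDegree (minpoly.degree_le_of_ne_zero K b hq0 h)
      omega
    rw [finrank_range_aeval_rangeCompression, hdeg] at hle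
    refine ⟨_, aeval (E * w) q * E, aeval_mul_mem_pow h1 hE hw q, ?_, ?_, ?_⟩
    · intro h
      have h3 := finrank_range_aeval_rangeCompression E w q
      rw [h, LinearMap.range_zero, finrank_bot, Submodule.finrank_eq_zero,
        LinearMap.range_eq_bot] at h3
      exact haq h3
    · nlinarith
    · calc ((ℓ + m) * q.natDegree + ℓ) * Module.finrank K (LinearMap.range (aeval (E * w) q * E))
          ≤ ((ℓ + m) * (q.natDegree + 1)) *
              Module.finrank K (LinearMap.range (aeval (E * w) q * E)) := by
            gcongr
            rw [mul_add]
            omega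
        _ = (ℓ + m) * ((q.natDegree + 1) *
              Module.finrank K (LinearMap.range (aeval (E * w) q * E))) := by ring
        _ ≤ (ℓ + m) * r := by gcongr
        _ ≤ ℓ * r + 4 * n := by rw [add_mul]; omega

/-- Iterated halving of the rank `r`, at most `Nat.log 2 r` times. -/
theorem exists_mem_pow_forall_mul_mul_mem_span_of_mem {S : Submodule K (Module.End K V)}
    (h1 : 1 ∈ S) (r : ℕ) : ∀ (ℓ : ℕ) (E : Module.End K V), E ∈ S ^ ℓ → E ≠ 0 →
      Module.finrank K (LinearMap.range E) = r →
      ∃ (ℓ' : ℕ) (E' : Module.End K V), E' ∈ S ^ ℓ' ∧ E' ≠ 0 ∧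
        (∀ p, ∀ w ∈ S ^ p, E' * w * E' ∈ Submodule.span K {E'}) ∧
        ℓ' ≤ ℓ * r + 4 * Module.finrank K V * Nat.log 2 r := by
  induction r using Nat.strong_induction_on with
  | _ r ih =>
  intro ℓ E hE hE0 hr
  have hr0 : 0 < r := by
    rw [← hr, Module.finrank_pos_iff, Submodule.nontrivial_iff_ne_bot]
    exact fun h => hE0 (LinearMap.range_eq_bot.mp h)
  by_cases hex : ∃ p, ∃ w ∈ S ^ p, E * w * E ∉ Submodule.span K {E}
  · obtain ⟨ℓ₁, E₁, hE₁, hE₁0, h2, h3⟩ := exists_mem_pow_two_mul_finrank_le h1 hE hex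
    have hr1 : 0 < Module.finrank K (LinearMap.range E₁) := by
      rw [Module.finrank_pos_iff, Submodule.nontrivial_iff_ne_bot]
      exact fun h => hE₁0 (LinearMap.range_eq_bot.mp h)
    rw [hr] at h2 h3
    obtain ⟨ℓ', E', hE', hE'0, hmin, hle⟩ := ih _ (by omega) ℓ₁ E₁ hE₁ hE₁0 rfl
    refine ⟨ℓ', E', hE', hE'0, hmin, hle.trans ?_⟩
    have h4 : Nat.log 2 (Module.finrank K (LinearMap.range E₁)) + 1 ≤ Nat.log 2 r := by
      rw [← Nat.log_mul_base (by norm_num) (by omega), mul_comm]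
      exact Nat.log_mono_right h2
    calc _ ≤ ℓ * r + 4 * Module.finrank K V + 4 * Module.finrank K V *
            Nat.log 2 (Module.finrank K (LinearMap.range E₁)) := by gcongr
      _ = ℓ * r + 4 * Module.finrank K V *
            (Nat.log 2 (Module.finrank K (LinearMap.range E₁)) + 1) := by ring
      _ ≤ _ := by gcongr
  · push Not at hex
    exact ⟨ℓ, E, hE, hE0, hex, by nlinarith⟩

/-- Words of length `O(n log n)` already span a nonzero operator `E` for which `E w E` is a multiple
of `E` for all `w` in the algebra. -/
theorem exists_mem_pow_forall_mul_mul_mem_span [Nontrivial V] {S : Submodule K (Module.End K V)}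
    (h1 : 1 ∈ S) :
    ∃ (E : Module.End K V),
      E ∈ S ^ (4 * Module.finrank K V * Nat.log 2 (Module.finrank K V)) ∧ E ≠ 0 ∧
        ∀ p, ∀ w ∈ S ^ p, E * w * E ∈ Submodule.span K {E} := by
  obtain ⟨ℓ, E, hE, hE0, h, hle⟩ := exists_mem_pow_forall_mul_mul_mem_span_of_mem h1
    (Module.finrank K V) 0 1 (by simp) one_ne_zero
      (by rw [Module.End.one_eq_id, LinearMap.range_id, finrank_top])
  rw [zero_mul, zero_add] at hle
  exact ⟨E, Submodule.pow_mono_of_one_mem h1 hle hE, hE0, h⟩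

end ShortWords

/-! ### Stabilising chains of subspaces and rank one matrices -/

section RankOne

variable {K : Type*} [Field K]

/-- An increasing chain of subspaces of dimension at most `n`, each term of which determines the
next, is constant from index `n` on. -/
theorem Submodule.le_of_iterate_of_finrank_le {A : Type*} [AddCommGroup A] [Module K A]
    [FiniteDimensional K A] (L : ℕ → Submodule K A) (Φ : Submodule K A → Submodule K A)
    (hΦ : ∀ m, L (m + 1) = Φ (L m)) (hmono : Monotone L) {n : ℕ}
    (hn : ∀ m, Module.finrank K (L m) ≤ n) (p : ℕ) : L p ≤ L n := by
  have hstab : ∃ m ≤ n, L (m + 1) = L m := by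
    by_contra! hcon
    have : ∀ m, m ≤ n + 1 → m ≤ Module.finrank K (L m) := by
      intro m
      induction m with
      | zero => simp
      | succ m ih =>
        intro hm
        have h1 := ih (by omega)
        have h2 : L m < L (m + 1) :=
          lt_of_le_of_ne (hmono (Nat.le_succ m)) (hcon m (by omega)).symm
        have := Submodule.finrank_lt_finrank_of_lt h2
        omega
    have h1 := this (n + 1) le_rfl
    have h2 := hn (n + 1)
    omega
  obtain ⟨m, hm, h⟩ := hstab
  have hconst : ∀ k, L (m + k) = L m := by
    intro k
    induction k with
    | zero => rfl
    | succ k ih => rw [← add_assoc, hΦ, ih, ← hΦ, h]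
  rcases le_total p m with hp | hp
  · exact hmono (hp.trans hm)
  · obtain ⟨k, rfl⟩ := Nat.exists_eq_add_of_le hp
    rw [hconst]
    exact hmono hm

theorem finrank_le_of_forall_mem_eq_apply {d : ℕ} {A : Type*} [AddCommGroup A] [Module K A]
    (N : Submodule K A) (φ : (Fin d → K) →ₗ[K] A) (h : ∀ z ∈ N, ∃ u, z = φ u) :
    Module.finrank K N ≤ d := by
  have hN : N ≤ LinearMap.range φ := by
    intro z hz
    obtain ⟨u, rfl⟩ := h z hz
    exact ⟨u, rfl⟩
  refine (Submodule.finrank_mono hN).trans ((LinearMap.finrank_range_le _).trans ?_)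
  simp

/-- Words of length `d` suffice for the left multiples of a rank one matrix: these form a space of
dimension at most `d`. -/
theorem exists_mem_pow_mul_vecMulVec_eq {d : ℕ} {S : Submodule K (Matrix (Fin d) (Fin d) K)}
    (h1 : 1 ∈ S) (hS : ∀ z, ∃ p, z ∈ S ^ p) (u v : Fin d → K) (z : Matrix (Fin d) (Fin d) K) :
    ∃ z' ∈ S ^ d, z' * Matrix.vecMulVec u v = z * Matrix.vecMulVec u v := by
  obtain ⟨p, hp⟩ := hS z
  have h := Submodule.le_of_iterate_of_finrank_le
    (fun m => S ^ m * Submodule.span K {Matrix.vecMulVec u v}) (fun X => S * X)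
    (fun m => by simp only [pow_succ', mul_assoc])
    (fun m n hmn => mul_le_mul' (Submodule.pow_mono_of_one_mem h1 hmn) le_rfl) (n := d)
    (fun m => finrank_le_of_forall_mem_eq_apply _
      ((vecMulVecBilin (R := K) (S := K)).flip v) (by
      intro x hx
      obtain ⟨y, -, rfl⟩ := Submodule.mem_mul_span_singleton.mp hx
      exact ⟨_, Matrix.mul_vecMulVec _ _ _⟩)) p
  exact Submodule.mem_mul_span_singleton.mp
    (h (Submodule.mul_mem_mul hp (Submodule.mem_span_singleton_self _)))

/-- Words of length `d` suffice for the right multiples of a rank one matrix. -/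
theorem exists_mem_pow_vecMulVec_mul_eq {d : ℕ} {S : Submodule K (Matrix (Fin d) (Fin d) K)}
    (h1 : 1 ∈ S) (hS : ∀ z, ∃ p, z ∈ S ^ p) (u v : Fin d → K) (z : Matrix (Fin d) (Fin d) K) :
    ∃ z' ∈ S ^ d, Matrix.vecMulVec u v * z' = Matrix.vecMulVec u v * z := by
  obtain ⟨p, hp⟩ := hS z
  have h := Submodule.le_of_iterate_of_finrank_le
    (fun m => Submodule.span K {Matrix.vecMulVec u v} * S ^ m) (fun X => X * S)
    (fun m => by simp only [pow_succ, mul_assoc])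
    (fun m n hmn => mul_le_mul' le_rfl (Submodule.pow_mono_of_one_mem h1 hmn)) (n := d)
    (fun m => finrank_le_of_forall_mem_eq_apply _ (vecMulVecBilin (R := K) (S := K) u) (by
      intro x hx
      obtain ⟨y, -, rfl⟩ := Submodule.mem_span_singleton_mul.mp hx
      exact ⟨_, Matrix.vecMulVec_mul _ _ _⟩)) p
  exact Submodule.mem_span_singleton_mul.mp
    (h (Submodule.mul_mem_mul (Submodule.mem_span_singleton_self _) hp))

theorem exists_mulVec_eq {d : ℕ} {u : Fin d → K} (hu : u ≠ 0) (x : Fin d → K) :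
    ∃ z : Matrix (Fin d) (Fin d) K, z.mulVec u = x := by
  obtain ⟨a, ha⟩ := Function.ne_iff.mp hu
  refine ⟨Matrix.vecMulVec x (Pi.single a (u a)⁻¹), ?_⟩
  rw [Matrix.vecMulVec_mulVec, single_dotProduct, inv_mul_cancel₀ ha]
  simp

theorem exists_vecMul_eq {d : ℕ} {v : Fin d → K} (hv : v ≠ 0) (x : Fin d → K) :
    ∃ z : Matrix (Fin d) (Fin d) K, Matrix.vecMul v z = x := by
  obtain ⟨z, hz⟩ := exists_mulVec_eq hv x
  exact ⟨z.transpose, by rw [Matrix.vecMul_transpose, hz]⟩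

/-- A nonzero functional on matrices does not vanish on all products `a * vecMulVec u v * b`, where
`a` and `b` are short words, each forced to contain a letter from `Y`. -/
theorem exists_apply_mul_vecMulVec_mul_ne_zero {d : ℕ}
    {S Y : Submodule K (Matrix (Fin d) (Fin d) K)} (h1 : 1 ∈ S) (hS : ∀ z, ∃ p, z ∈ S ^ p)
    (hY : ∃ y ∈ Y, y ≠ 0) {u v : Fin d → K} (hu : u ≠ 0) (hv : v ≠ 0)
    {g : Matrix (Fin d) (Fin d) K →ₗ[K] K} (hg : ∃ z, g z ≠ 0) :
    ∃ a ∈ S ^ d * Y * S ^ d, ∃ b ∈ S ^ d * Y * S ^ d, g (a * Matrix.vecMulVec u v * b) ≠ 0 := by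
  obtain ⟨y, hyY, hy⟩ := hY
  have hyx : ∃ x, y.mulVec x ≠ 0 := by
    by_contra! h
    exact hy (Matrix.ext_of_mulVec_single fun i => by rw [h, Matrix.zero_mulVec])
  have hyx' : ∃ x, Matrix.vecMul x y ≠ 0 := by
    by_contra! h
    exact hy (Matrix.ext_of_single_vecMul fun i => by rw [h, Matrix.vecMul_zero])
  obtain ⟨x, hx⟩ := hyx
  obtain ⟨x', hx'⟩ := hyx'
  obtain ⟨i, j, hij⟩ : ∃ i j, g (Matrix.single i j 1) ≠ 0 := by
    by_contra! h
    obtain ⟨z, hz⟩ := hg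
    apply hz
    rw [Matrix.matrix_eq_sum_single z]
    simp only [map_sum]
    refine Finset.sum_eq_zero fun i _ => Finset.sum_eq_zero fun j _ => ?_
    rw [← mul_one (z i j), ← smul_eq_mul, ← Matrix.smul_single, map_smul, h, smul_zero]
  -- `y` and the short words move `u` to `y *ᵥ x` and `v` to `x' ᵥ* y`; further short words move
  -- these to the basis vectors `i` and `j`
  obtain ⟨z₁, hz₁⟩ := exists_mulVec_eq hu x
  obtain ⟨z₂, hz₂⟩ := exists_vecMul_eq hv x'
  obtain ⟨z₃, hz₃⟩ := exists_mulVec_eq hx (Pi.single i 1)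
  obtain ⟨z₄, hz₄⟩ := exists_vecMul_eq hx' (Pi.single j 1)
  obtain ⟨a₁, ha₁, h₁⟩ := exists_mem_pow_mul_vecMulVec_eq h1 hS u v z₁
  obtain ⟨a₂, ha₂, h₂⟩ := exists_mem_pow_vecMulVec_mul_eq h1 hS (y.mulVec x) v z₂
  obtain ⟨a₃, ha₃, h₃⟩ :=
    exists_mem_pow_mul_vecMulVec_eq h1 hS (y.mulVec x) (Matrix.vecMul x' y) z₃
  obtain ⟨a₄, ha₄, h₄⟩ :=
    exists_mem_pow_vecMulVec_mul_eq h1 hS (Pi.single i 1) (Matrix.vecMul x' y) z₄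
  refine ⟨a₃ * y * a₁, Submodule.mul_mem_mul (Submodule.mul_mem_mul ha₃ hyY) ha₁,
    a₂ * y * a₄, Submodule.mul_mem_mul (Submodule.mul_mem_mul ha₂ hyY) ha₄, ?_⟩
  have : a₃ * y * a₁ * Matrix.vecMulVec u v * (a₂ * y * a₄) = Matrix.single i j 1 := by
    calc _ = a₃ * (y * (a₁ * Matrix.vecMulVec u v) * a₂ * y) * a₄ := by simp only [mul_assoc]
      _ = a₃ * ((Matrix.vecMulVec (y.mulVec x) v * a₂) * y) * a₄ := by
        rw [h₁, Matrix.mul_vecMulVec, hz₁, Matrix.mul_vecMulVec]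
      _ = Matrix.vecMulVec (Pi.single i 1) (Matrix.vecMul x' y) * a₄ := by
        rw [h₂, Matrix.vecMulVec_mul, hz₂, Matrix.vecMulVec_mul, h₃, Matrix.mul_vecMulVec, hz₃]
      _ = Matrix.single i j 1 := by
        rw [h₄, Matrix.vecMulVec_mul, hz₄, Matrix.single_eq_single_vecMulVec_single]
  rw [this]
  exact hij

theorem Submodule.pow_mul_one_sup_pow_le {A : Type*} [Ring A] [Algebra K A] {Y N : Submodule K A}
    (m : ℕ) : ∀ i, (∀ k, i ≤ k → k ≤ i + m → Y ^ k ≤ N) → Y ^ i * (1 ⊔ Y) ^ m ≤ N := by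
  induction m with
  | zero => intro i h; simpa using h i le_rfl le_rfl
  | succ m ih =>
    intro i h
    rw [pow_succ', ← mul_assoc, Submodule.mul_sup, mul_one, ← pow_succ, Submodule.sup_mul]
    exact sup_le (ih i fun k h1 h2 => h k h1 (by omega))
      (ih (i + 1) fun k h1 h2 => h k (by omega) (by omega))

theorem Submodule.one_sup_pow_mul_comm {A : Type*} [Ring A] [Algebra K A] (Y : Submodule K A)
    (m : ℕ) : (1 ⊔ Y) ^ m * Y = Y * (1 ⊔ Y) ^ m := by
  have : Commute (1 ⊔ Y) Y := ((Commute.one_right Y).add_right (Commute.refl Y)).symm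
  exact (this.pow_left m).eq

end RankOne

/-! ### Functionals on products of matrix algebras -/

section PiMatrix

variable {K : Type*} [Field K] {ι : Type*} {d : ι → ℕ}

/-- The representation of `∏ j, M_{d j}(K)` on the product of the spaces `K ^ (d j)` over the
factors `j ∈ T`. -/
def blockRep (T : Set ι) : (Π j, Matrix (Fin (d j)) (Fin (d j)) K) →ₐ[K]
    Module.End K (Π j : T, Fin (d j) → K) where
  toFun z := LinearMap.pi fun j => (Matrix.mulVecLin (z j)) ∘ₗ LinearMap.proj j
  map_one' := by ext; simp
  map_mul' x y := by ext; simp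
  map_zero' := by ext; simp
  map_add' x y := by ext; simp
  commutes' c := by
    refine LinearMap.ext fun v => funext fun j => ?_
    simp [Algebra.algebraMap_eq_smul_one]

theorem blockRep_apply (T : Set ι) (z : Π j, Matrix (Fin (d j)) (Fin (d j)) K)
    (v : Π j : T, Fin (d j) → K) (j : T) : blockRep T z v j = (z j).mulVec (v j) := rfl

theorem blockRep_eq_iff [DecidableEq ι] (T : Set ι) (z w : Π j, Matrix (Fin (d j)) (Fin (d j)) K) :
    blockRep T z = blockRep T w ↔ ∀ j ∈ T, z j = w j := by
  constructor
  · intro h j hj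
    refine Matrix.ext_of_mulVec_single fun i => ?_
    have := congrFun (LinearMap.congr_fun h (Pi.single ⟨j, hj⟩ (Pi.single i 1))) ⟨j, hj⟩
    simpa [blockRep_apply] using this
  · intro h
    refine LinearMap.ext fun v => funext fun j => ?_
    rw [blockRep_apply, blockRep_apply, h j j.2]

/-- A short element of a product of matrix algebras which has rank one on one of the factors
in `T` and vanishes on the others. -/
theorem exists_mem_pow_eq_vecMulVec [IsAlgClosed K] [Fintype ι] [DecidableEq ι]
    {S : Submodule K (Π j, Matrix (Fin (d j)) (Fin (d j)) K)} (h1 : 1 ∈ S)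
    (hS : ∀ z, ∃ p, z ∈ S ^ p) (T : Set ι) (hT : ∃ j ∈ T, 0 < d j) {n : ℕ} (hn : ∑ j, d j ≤ n) :
    ∃ e ∈ S ^ (4 * n * Nat.log 2 n), ∃ j₀ ∈ T, ∃ u v : Fin (d j₀) → K, u ≠ 0 ∧ v ≠ 0 ∧
      e j₀ = Matrix.vecMulVec u v ∧ ∀ j ∈ T, j ≠ j₀ → e j = 0 := by
  classical
  have : Nontrivial (Π j : T, Fin (d j) → K) := by
    obtain ⟨j, hj, hd⟩ := hT
    have : Nonempty (Fin (d j)) := ⟨⟨0, hd⟩⟩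
    exact ⟨⟨0, Pi.single ⟨j, hj⟩ 1, fun h => by
      have := congrFun (congrFun h ⟨j, hj⟩) ⟨0, hd⟩
      simp at this⟩⟩
  have hfin : Module.finrank K (Π j : T, Fin (d j) → K) ≤ n := by
    rw [Module.finrank_pi_fintype]
    simp only [Module.finrank_fintype_fun_eq_card, Fintype.card_fin]
    refine le_trans ?_ hn
    rw [Finset.sum_set_coe T (f := d)]
    exact Finset.sum_le_sum_of_subset (Finset.subset_univ _)
  have hmap : ∀ p, (S.map (blockRep T).toLinearMap) ^ p = (S ^ p).map (blockRep T).toLinearMap :=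
    fun p => (Submodule.map_pow S (blockRep T) p).symm
  obtain ⟨E, hE, hE0, hmin⟩ := exists_mem_pow_forall_mul_mul_mem_span
    (S := S.map (blockRep T).toLinearMap) ⟨1, h1, map_one (blockRep T)⟩
  have hlen : 4 * Module.finrank K (Π j : T, Fin (d j) → K) *
      Nat.log 2 (Module.finrank K (Π j : T, Fin (d j) → K)) ≤ 4 * n * Nat.log 2 n := by
    have := Nat.log_mono_right (b := 2) hfin
    gcongr
  rw [hmap] at hE
  obtain ⟨e, he, rfl⟩ := hE
  simp only [AlgHom.toLinearMap_apply] at hE0 hmin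
  have hmin' : ∀ z : Π j, Matrix (Fin (d j)) (Fin (d j)) K, ∃ c : K, ∀ j ∈ T,
      e j * z j * e j = c • e j := by
    intro z
    obtain ⟨p, hp⟩ := hS z
    have := hmin p (blockRep T z) (by rw [hmap]; exact ⟨z, hp, rfl⟩)
    obtain ⟨c, hc⟩ := Submodule.mem_span_singleton.mp this
    refine ⟨c, fun j hj => ?_⟩
    rw [← map_smul, ← map_mul, ← map_mul, blockRep_eq_iff] at hc
    simpa using (hc j hj).symm
  have hex : ∃ j ∈ T, e j ≠ 0 := by
    by_contra! h
    apply hE0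
    rw [← map_zero (blockRep T), blockRep_eq_iff]
    exact h
  obtain ⟨j₀, hj₀, hej⟩ := hex
  obtain ⟨a, b, hab⟩ : ∃ a b, e j₀ a b ≠ 0 := by
    by_contra! h
    exact hej (Matrix.ext h)
  -- sandwiching a matrix unit of the factor `j₀` gives a rank one multiple of `e j₀` and kills the
  -- other factors
  obtain ⟨c, hc⟩ := hmin' (Pi.single j₀ (Matrix.single b a 1))
  have hcol : e j₀ * Matrix.single b a 1 * e j₀ =
      Matrix.vecMulVec (fun i => e j₀ i b) (e j₀ a) := by
    rw [Matrix.single_eq_single_vecMulVec_single, Matrix.mul_vecMulVec, Matrix.vecMulVec_mul,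
      Matrix.mulVec_single_one, Matrix.single_one_vecMul]
    rfl
  have hc0 : c ≠ 0 := by
    rintro rfl
    have h2 := hc j₀ hj₀
    rw [Pi.single_eq_same, hcol, zero_smul] at h2
    have := congrFun (congrFun h2 a) b
    simp [Matrix.vecMulVec_apply] at this
    exact hab this
  refine ⟨e, Submodule.pow_mono_of_one_mem h1 hlen he, j₀, hj₀, c⁻¹ • fun i => e j₀ i b, e j₀ a,
    smul_ne_zero (inv_ne_zero hc0) fun h => hab (congrFun h a), fun h => hab (congrFun h b),
    ?_, ?_⟩
  · have h2 := hc j₀ hj₀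
    rw [Pi.single_eq_same, hcol] at h2
    rw [Matrix.smul_vecMulVec, h2, smul_smul, inv_mul_cancel₀ hc0, one_smul]
  · intro j hj hne
    have h2 := hc j hj
    rw [Pi.single_eq_of_ne hne, mul_zero, zero_mul] at h2
    exact (smul_eq_zero.mp h2.symm).resolve_left hc0

/-- A functional on a product of matrix algebras that vanishes on all products of at least two
and at most `N` elements of a generating subspace `Y` vanishes on `Y`. -/
theorem apply_eq_zero_of_forall_pow_of_pi_matrix [IsAlgClosed K] [Fintype ι] [DecidableEq ι]
    {Y : Submodule K (Π j, Matrix (Fin (d j)) (Fin (d j)) K)}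
    (hY : ∀ z, ∃ p, z ∈ (1 ⊔ Y) ^ p) {n N : ℕ} (hn : ∑ j, d j ≤ n)
    (hN : 4 * n * Nat.log 2 n + 4 * n + 2 ≤ N)
    (f : (Π j, Matrix (Fin (d j)) (Fin (d j)) K) →ₗ[K] K)
    (hf : ∀ k, 2 ≤ k → k ≤ N → ∀ z ∈ Y ^ k, f z = 0) : ∀ y ∈ Y, f y = 0 := by
  classical
  by_contra! hcon
  obtain ⟨y, hy, hfy⟩ := hcon
  have hsum : ∀ z, f z = ∑ j, f (Pi.single j (z j)) := fun z => by
    rw [← map_sum, Finset.univ_sum_single]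
  have h1 : (1 : Π j, Matrix (Fin (d j)) (Fin (d j)) K) ∈ 1 ⊔ Y :=
    Submodule.mem_sup_left (Submodule.one_le.mp le_rfl)
  -- only the factors on which neither `f` nor `Y` vanishes matter
  set T : Set ι := {j | (∃ x, f (Pi.single j x) ≠ 0) ∧ ∃ y ∈ Y, y j ≠ 0} with hTdef
  have hT : ∃ j ∈ T, 0 < d j := by
    rw [hsum] at hfy
    obtain ⟨j, -, hj⟩ := Finset.exists_ne_zero_of_sum_ne_zero hfy
    have hyj : y j ≠ 0 := fun h => hj (by rw [h]; simp)
    refine ⟨j, ⟨⟨_, hj⟩, y, hy, hyj⟩, Nat.pos_of_ne_zero fun h => hyj ?_⟩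
    have : IsEmpty (Fin (d j)) := by rw [h]; infer_instance
    exact Subsingleton.elim _ _
  obtain ⟨e, he, j₀, hj₀, u, v, hu, hv, hej, he0⟩ := exists_mem_pow_eq_vecMulVec h1 hY T hT hn
  -- pass to the factor `j₀`
  let π := Pi.evalAlgHom K (fun j => Matrix (Fin (d j)) (Fin (d j)) K) j₀
  have hmap : ∀ p, ((1 ⊔ Y).map π.toLinearMap) ^ p = ((1 ⊔ Y) ^ p).map π.toLinearMap :=
    fun p => (Submodule.map_pow _ π p).symm
  obtain ⟨⟨x, hx⟩, y', hy', hyj'⟩ := hj₀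
  obtain ⟨a, ha, b, hb, hab⟩ := exists_apply_mul_vecMulVec_mul_ne_zero
    (S := (1 ⊔ Y).map π.toLinearMap) (Y := Y.map π.toLinearMap) ⟨1, h1, map_one π⟩
    (fun z => by
      obtain ⟨p, hp⟩ := hY (Pi.single j₀ z)
      exact ⟨p, by rw [hmap]; exact ⟨_, hp, by simp [π]⟩⟩)
    ⟨_, ⟨y', hy', rfl⟩, hyj'⟩ hu hv
    (g := f ∘ₗ LinearMap.single K (fun j => Matrix (Fin (d j)) (Fin (d j)) K) j₀) ⟨x, hx⟩
  have hmul : ∀ P Q : Submodule K (Π j, Matrix (Fin (d j)) (Fin (d j)) K),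
      P.map π.toLinearMap * Q.map π.toLinearMap = (P * Q).map π.toLinearMap :=
    fun P Q => (Submodule.map_mul P Q π).symm
  rw [hmap, hmul, hmul] at ha hb
  obtain ⟨a, ha, rfl⟩ := ha
  obtain ⟨b, hb, rfl⟩ := hb
  have hvan : ∀ z ∈ (1 ⊔ Y) ^ (d j₀) * Y * (1 ⊔ Y) ^ (d j₀), ∀ j, (∀ y ∈ Y, y j = 0) → z j = 0 := by
    intro z hz j hj
    have hle : (1 ⊔ Y) ^ (d j₀) * Y * (1 ⊔ Y) ^ (d j₀) ≤
        LinearMap.ker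
          (LinearMap.proj (R := K) (φ := fun j => Matrix (Fin (d j)) (Fin (d j)) K) j) := by
      rw [Submodule.one_sup_pow_mul_comm, mul_assoc, Submodule.mul_le]
      intro y hy x _
      simp [hj y hy]
    exact hle hz
  have hz0 : f (a * e * b) ≠ 0 := by
    rw [hsum, Finset.sum_eq_single j₀]
    · rw [Pi.mul_apply, Pi.mul_apply, hej]
      exact hab
    · intro j _ hne
      by_cases hjT : j ∈ T
      · rw [Pi.mul_apply, Pi.mul_apply, he0 j hjT hne]; simp
      · rw [hTdef, Set.mem_ofPred_eq, not_and_or] at hjT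
        push Not at hjT
        rcases hjT with h | h
        · exact h _
        · rw [Pi.mul_apply, Pi.mul_apply, hvan a ha j h]; simp
    · simp
  have hdn : d j₀ ≤ n := (Finset.single_le_sum (fun j _ => Nat.zero_le (d j))
    (Finset.mem_univ j₀)).trans hn
  have hmem : a * e * b ∈ Y ^ 2 * (1 ⊔ Y) ^ (4 * n * Nat.log 2 n + 4 * d j₀) := by
    have := Submodule.mul_mem_mul (Submodule.mul_mem_mul ha he) hb
    have heq : (1 ⊔ Y) ^ d j₀ * Y * (1 ⊔ Y) ^ d j₀ * (1 ⊔ Y) ^ (4 * n * Nat.log 2 n) *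
        ((1 ⊔ Y) ^ d j₀ * Y * (1 ⊔ Y) ^ d j₀) =
        Y ^ 2 * (1 ⊔ Y) ^ (4 * n * Nat.log 2 n + 4 * d j₀) := by
      have h := Submodule.one_sup_pow_mul_comm Y
      rw [h (d j₀)]
      calc _ = Y * ((1 ⊔ Y) ^ (d j₀ + d j₀ + 4 * n * Nat.log 2 n) * Y) *
            (1 ⊔ Y) ^ (d j₀ + d j₀) := by simp only [pow_add, mul_assoc]
        _ = _ := by
          rw [h, pow_two, show 4 * n * Nat.log 2 n + 4 * d j₀ =
            d j₀ + d j₀ + 4 * n * Nat.log 2 n + (d j₀ + d j₀) by ring]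
          simp only [pow_add, mul_assoc]
    rwa [heq] at this
  have hker := Submodule.pow_mul_one_sup_pow_le (N := LinearMap.ker f) (Y := Y)
    (4 * n * Nat.log 2 n + 4 * d j₀) 2 (fun k h2 hk z hz => hf k h2 (by omega) z hz)
  exact hz0 (hker hmem)

end PiMatrix

/-! ### Passing to the semisimple quotient -/

section Semisimple

variable {K : Type*} [Field K]

theorem exists_mem_one_sup_pow_of_mem_adjoin {A : Type*} [Ring A] [Algebra K A]
    (Y : Submodule K A) {w : A} (hw : w ∈ Algebra.adjoin K (Y : Set A)) :
    ∃ p, w ∈ (1 ⊔ Y) ^ p := by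
  have h1 : (1 : A) ∈ 1 ⊔ Y := Submodule.mem_sup_left (Submodule.one_le.mp le_rfl)
  induction hw using Algebra.adjoin_induction with
  | mem x hx => exact ⟨1, by rw [pow_one]; exact Submodule.mem_sup_right hx⟩
  | algebraMap r => exact ⟨0, by rw [pow_zero]; exact Submodule.algebraMap_mem r⟩
  | add x y _ _ hx hy =>
    obtain ⟨p, hp⟩ := hx
    obtain ⟨q, hq⟩ := hy
    exact ⟨p + q, Submodule.add_mem _ (Submodule.pow_mono_of_one_mem h1 (Nat.le_add_right p q) hp)
      (Submodule.pow_mono_of_one_mem h1 (Nat.le_add_left q p) hq)⟩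
  | mul x y _ _ hx hy =>
    obtain ⟨p, hp⟩ := hx
    obtain ⟨q, hq⟩ := hy
    exact ⟨p + q, by rw [pow_add]; exact Submodule.mul_mem_mul hp hq⟩

/-- A unit that normalises a subspace normalises the algebra generated by it. -/
theorem conj_mem_adjoin {A : Type*} [Ring A] [Algebra K A] {Y : Submodule K A} (H : Aˣ)
    (hY : ∀ y ∈ Y, ↑H⁻¹ * y * ↑H ∈ Y) {w : A} (hw : w ∈ Algebra.adjoin K (Y : Set A)) :
    ↑H⁻¹ * w * ↑H ∈ Algebra.adjoin K (Y : Set A) := by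
  induction hw using Algebra.adjoin_induction with
  | mem x hx => exact Algebra.subset_adjoin (hY x hx)
  | algebraMap r =>
    rw [mul_assoc, Algebra.commutes, ← mul_assoc, Units.inv_mul, one_mul]
    exact Subalgebra.algebraMap_mem _ r
  | add x y _ _ hx hy =>
    rw [mul_add, add_mul]
    exact add_mem hx hy
  | mul x y _ _ hx hy =>
    have := mul_mem hx hy
    rwa [show ↑H⁻¹ * x * ↑H * (↑H⁻¹ * y * ↑H) = ↑H⁻¹ * (x * (↑H * ↑H⁻¹) * y) * ↑H by
      simp only [mul_assoc], Units.mul_inv, mul_one] at this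

/-- A unit normalising a subalgebra with nilpotent Jacobson radical, times an element of that
radical, is nilpotent. -/
theorem isNilpotent_unit_mul_of_mem_jacobson {A : Type*} [Ring A] [Algebra K A]
    (W : Subalgebra K A) (H : Aˣ) (h1 : ∀ w ∈ W, ↑H⁻¹ * w * ↑H ∈ W)
    (h2 : ∀ w ∈ W, ↑H * w * ↑H⁻¹ ∈ W) (hJ : IsNilpotent (Ring.jacobson W)) {x : W}
    (hx : x ∈ Ring.jacobson W) : IsNilpotent (↑H * (x : A)) := by
  let θ : W ≃+* W :=
    { toFun := fun w => ⟨↑H⁻¹ * w * ↑H, h1 w w.2⟩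
      invFun := fun w => ⟨↑H * w * ↑H⁻¹, h2 w w.2⟩
      left_inv := fun w => Subtype.ext (by simp [mul_assoc])
      right_inv := fun w => Subtype.ext (by simp [mul_assoc])
      map_mul' := fun a b => Subtype.ext (by simp [mul_assoc])
      map_add' := fun a b => Subtype.ext (by simp [mul_add, add_mul]) }
  have hθ : ∀ w ∈ Ring.jacobson W, θ w ∈ Ring.jacobson W := by
    have : RingHomSurjective (θ : W →+* W) := ⟨θ.surjective⟩
    exact fun w hw => Ring.le_comap_jacobson (θ : W →+* W) hw
  have hiter : ∀ k : ℕ, ∃ z ∈ Ring.jacobson W, (x : A) * (H : A) ^ k = (H : A) ^ k * (z : A) := by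
    intro k
    induction k with
    | zero => exact ⟨x, hx, by simp⟩
    | succ k ih =>
      obtain ⟨z, hz, h⟩ := ih
      refine ⟨θ z, hθ z hz, ?_⟩
      rw [pow_succ, ← mul_assoc, h]
      change _ = _ * (↑H⁻¹ * (z : A) * ↑H)
      simp [mul_assoc]
  have hpow : ∀ k : ℕ, ∃ y ∈ Ring.jacobson W ^ k, (↑H * (x : A)) ^ k = (H : A) ^ k * (y : A) := by
    intro k
    induction k with
    | zero => exact ⟨1, by rw [Submodule.pow_zero, Ideal.one_eq_top]; trivial, by simp⟩
    | succ k ih =>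
      obtain ⟨y, hy, h⟩ := ih
      obtain ⟨z, hz, hz'⟩ := hiter k
      refine ⟨z * y, by rw [Ideal.IsTwoSided.pow_succ]; exact Ideal.mul_mem_mul hz hy, ?_⟩
      rw [pow_succ', h, mul_assoc, ← mul_assoc (x : A), hz', pow_succ']
      simp [mul_assoc]
  obtain ⟨k, hk⟩ := hJ
  obtain ⟨y, hy, h⟩ := hpow k
  rw [hk] at hy
  refine ⟨k, ?_⟩
  rw [h, show y = 0 from hy]
  simp

/-- If a product of matrix algebras is a quotient of an algebra of `n × n` matrices, its total
degree is at most `n`: a diagonal element with distinct entries is a root of a characteristic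
polynomial of degree `n`. -/
theorem sum_degree_le_of_surjective_pi_matrix [Infinite K] {n : ℕ}
    (W : Subalgebra K (Matrix (Fin n) (Fin n) K))
    {ι : Type} [Fintype ι] {d : ι → ℕ} (φ : W →ₐ[K] Π j, Matrix (Fin (d j)) (Fin (d j)) K)
    (hφ : Function.Surjective φ) : ∑ j, d j ≤ n := by
  classical
  obtain ⟨c⟩ : Nonempty ((Σ j, Fin (d j)) ↪ K) := by
    have := Infinite.exists_superset_card_eq (∅ : Finset K) (Fintype.card (Σ j, Fin (d j)))
      (by simp)
    obtain ⟨s, -, hs⟩ := this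
    exact ⟨(Fintype.equivFin (Σ j, Fin (d j))).toEmbedding.trans
      ((Fintype.equivFinOfCardEq (α := s) (by simpa using hs)).symm.toEmbedding.trans
        (Function.Embedding.subtype _))⟩
  obtain ⟨w, hw⟩ := hφ fun j => Matrix.diagonal fun i => c ⟨j, i⟩
  set χ := (w : Matrix (Fin n) (Fin n) K).charpoly with hχ
  have h0 : aeval w χ = 0 := by
    have h1 : W.val (aeval w χ) = 0 := by
      rw [← aeval_algHom_apply]
      exact Matrix.aeval_self_charpoly _
    exact Subtype.ext h1
  have hroot : ∀ p, χ.IsRoot (c p) := by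
    rintro ⟨j, i⟩
    have h1 : aeval (φ w) χ = 0 := by rw [aeval_algHom_apply, h0, map_zero]
    have h2 : aeval (φ w j) χ = 0 := by
      have := aeval_algHom_apply (Pi.evalAlgHom K (fun j => Matrix (Fin (d j)) (Fin (d j)) K) j)
        (φ w) χ
      rw [h1, map_zero] at this
      exact this
    rw [hw] at h2
    have h3 := aeval_algHom_apply (Matrix.diagonalAlgHom K (n := Fin (d j)) (α := K))
      (fun i => c ⟨j, i⟩) χ
    rw [Matrix.diagonalAlgHom_apply, h2] at h3
    have h4 := congrFun (congrFun h3 i) i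
    rw [Matrix.diagonalAlgHom_apply, Matrix.diagonal_apply_eq] at h4
    have h5 := aeval_algHom_apply (Pi.evalAlgHom K (fun _ : Fin (d j) => K) i)
      (fun i => c ⟨j, i⟩) χ
    rw [Pi.evalAlgHom_apply, Pi.evalAlgHom_apply, ← h4] at h5
    rw [IsRoot.def, ← coe_aeval_eq_eval]
    exact h5
  have hχ0 : χ ≠ 0 := (Matrix.charpoly_monic _).ne_zero
  have hle : (Finset.univ.map c).val ≤ χ.roots := by
    rw [Multiset.le_iff_subset (Finset.nodup _)]
    intro a ha
    obtain ⟨p, -, rfl⟩ := Finset.mem_map.mp (Finset.mem_val.mp ha)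
    exact (mem_roots hχ0).mpr (hroot p)
  have h1 := Multiset.card_le_card hle
  have h2 := χ.card_roots'
  rw [hχ, Matrix.charpoly_natDegree_eq_dim, Fintype.card_fin] at h2
  simp only [Finset.card_val, Finset.card_map, Finset.card_univ, Fintype.card_sigma,
    Fintype.card_fin] at h1
  exact h1.trans h2

/-- Let `H` be an invertible `n × n` matrix normalising a subspace `Y`. If `trace (H * z)` vanishes
for all products `z` of at least two and at most `N` elements of `Y`, where `N` is of order
`n log n`, then it vanishes for `z ∈ Y`. -/
theorem trace_mul_eq_zero_of_forall_pow [IsAlgClosed K] {n N : ℕ}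
    {Y : Submodule K (Matrix (Fin n) (Fin n) K)} (H : (Matrix (Fin n) (Fin n) K)ˣ)
    (hY1 : ∀ y ∈ Y, H⁻¹.val * y * H.val ∈ Y) (hY2 : ∀ y ∈ Y, H.val * y * H⁻¹.val ∈ Y)
    (hN : 4 * n * Nat.log 2 n + 4 * n + 2 ≤ N)
    (hf : ∀ k, 2 ≤ k → k ≤ N → ∀ z ∈ Y ^ k, (H.val * z).trace = 0) :
    ∀ y ∈ Y, (H.val * y).trace = 0 := by
  classical
  set W := Algebra.adjoin K (Y : Set (Matrix (Fin n) (Fin n) K)) with hW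
  have hfinW : FiniteDimensional K W := FiniteDimensional.finiteDimensional_subalgebra _
  have hart : IsArtinianRing W := IsArtinianRing.of_finite K W
  let J := Ring.jacobson W
  have hfinQ : FiniteDimensional K (W ⧸ J) :=
    Module.Finite.of_surjective (Ideal.Quotient.mkₐ K J).toLinearMap Ideal.Quotient.mk_surjective
  obtain ⟨m, d, -, ⟨ψ⟩⟩ := IsSemisimpleRing.exists_algEquiv_pi_matrix_of_isAlgClosed K (W ⧸ J)
  let φ : W →ₐ[K] Π j, Matrix (Fin (d j)) (Fin (d j)) K :=
    (ψ : (W ⧸ J) →ₐ[K] _).comp (Ideal.Quotient.mkₐ K J)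
  have hφ : Function.Surjective φ := ψ.surjective.comp Ideal.Quotient.mk_surjective
  have hker : ∀ w, φ w = 0 → w ∈ J := by
    intro w hw
    have : Ideal.Quotient.mkₐ K J w = 0 := ψ.injective (by rw [map_zero]; exact hw)
    exact Ideal.Quotient.eq_zero_iff_mem.mp this
  have hinf : Infinite K := IsAlgClosed.instInfinite
  have hsum := sum_degree_le_of_surjective_pi_matrix W φ hφ
  -- the functional `w ↦ trace (H * w)` descends to the semisimple quotient
  let f : W →ₗ[K] K := Matrix.traceLinearMap (Fin n) K K ∘ₗ
    LinearMap.mulLeft K (H : Matrix (Fin n) (Fin n) K) ∘ₗ W.val.toLinearMap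
  have hfJ : ∀ w ∈ J, f w = 0 := by
    intro w hw
    have := isNilpotent_unit_mul_of_mem_jacobson W H (fun w hw => conj_mem_adjoin H hY1 hw)
      (fun w hw => by simpa using conj_mem_adjoin H⁻¹ (by simpa using hY2) hw)
      IsSemiprimaryRing.isNilpotent hw
    exact (Matrix.isNilpotent_trace_of_isNilpotent this).eq_zero
  obtain ⟨g, hg⟩ := φ.toLinearMap.exists_rightInverse_of_surjective
    (LinearMap.range_eq_top.mpr hφ)
  have hfg : ∀ w, (f ∘ₗ g) (φ w) = f w := by
    intro w
    have h1 : φ (g (φ w)) = φ w := LinearMap.congr_fun hg (φ w)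
    have h2 := hfJ _ (hker (g (φ w) - w) (by rw [map_sub, h1, sub_self]))
    rw [map_sub, sub_eq_zero] at h2
    exact h2
  let Y' : Submodule K W := Y.comap W.val.toLinearMap
  have hY'map : Y'.map W.val.toLinearMap = Y := by
    rw [Submodule.map_comap_eq, inf_eq_right]
    exact fun y hy => ⟨⟨y, Algebra.subset_adjoin hy⟩, rfl⟩
  have hpowW : ∀ w : W, ∃ p, w ∈ (1 ⊔ Y') ^ p := by
    intro w
    obtain ⟨p, hp⟩ := exists_mem_one_sup_pow_of_mem_adjoin Y w.2
    refine ⟨p, ?_⟩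
    have h1 : ((1 ⊔ Y') ^ p).map W.val.toLinearMap = (1 ⊔ Y) ^ p := by
      rw [Submodule.map_pow, Submodule.map_sup, Submodule.map_one, hY'map]
    rw [← h1] at hp
    obtain ⟨w', hw', h⟩ := hp
    rwa [← Subtype.ext (a1 := w') (a2 := w) h]
  have hfin := apply_eq_zero_of_forall_pow_of_pi_matrix (Y := Y'.map φ.toLinearMap)
    (n := n) (N := N)
    (fun z => by
      obtain ⟨w, rfl⟩ := hφ z
      obtain ⟨p, hp⟩ := hpowW w
      refine ⟨p, ?_⟩
      have h1 : ((1 ⊔ Y') ^ p).map φ.toLinearMap = (1 ⊔ Y'.map φ.toLinearMap) ^ p := by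
        rw [Submodule.map_pow, Submodule.map_sup, Submodule.map_one]
      rw [← h1]
      exact ⟨w, hp, rfl⟩) hsum hN (f ∘ₗ g) (fun k h2 hk z hz => by
      rw [← Submodule.map_pow] at hz
      obtain ⟨w, hw, rfl⟩ := hz
      have h1 : W.val w ∈ Y ^ k := by
        rw [← hY'map, ← Submodule.map_pow]
        exact ⟨w, hw, rfl⟩
      exact (hfg w).trans (hf k h2 hk _ h1))
  intro y hy
  have := hfin (φ ⟨y, Algebra.subset_adjoin hy⟩) ⟨_, hy, rfl⟩
  rw [hfg] at this
  exact this

end Semisimple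

/-! ### Traces of words in two matrices -/

section Words

variable {K : Type*} [Field K]

/-- The Fitting idempotent `P` of a matrix `A`, and the inverse `C` of `A` on the range of `P`. -/
theorem exists_fitting_idempotent {D : ℕ} (A : Matrix (Fin D) (Fin D) K) :
    ∃ P C : Matrix (Fin D) (Fin D) K, P * P = P ∧ A * P = P * A ∧ A * C = P ∧ C * A = P ∧
      P * C = C ∧ C * P = C ∧ ∀ m, D ≤ m → A ^ m * P = A ^ m := by
  have hχ0 : A.charpoly ≠ 0 := A.charpoly_monic.ne_zero
  obtain ⟨h, hh, hXh⟩ := exists_eq_pow_rootMultiplicity_mul_and_not_dvd A.charpoly hχ0 0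
  set k := A.charpoly.rootMultiplicity 0 with hk
  rw [C_0, sub_zero] at hh hXh
  have hkD : k ≤ D := by
    have := natDegree_le_of_dvd (Dvd.intro _ hh.symm) hχ0
    rwa [natDegree_X_pow, Matrix.charpoly_natDegree_eq_dim, Fintype.card_fin] at this
  obtain ⟨a, b, hab⟩ : IsCoprime ((X : K[X]) ^ (k + 1)) h :=
    IsCoprime.pow_left ((irreducible_X.coprime_iff_not_dvd).mpr hXh)
  have hzero : ∀ p q : K[X], A.charpoly ∣ p - q → aeval A p = aeval A q := by
    rintro p q ⟨r, hr⟩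
    rw [← sub_eq_zero, ← map_sub, hr, map_mul, Matrix.aeval_self_charpoly, zero_mul]
  have hXA : aeval A (X : K[X]) = A := aeval_X A
  set p := a * X ^ (k + 1) with hp
  have hbh : b * h = 1 - p := by rw [← hab]; ring
  have hpp : aeval A p * aeval A p = aeval A p := by
    rw [← map_mul]
    refine hzero _ _ ⟨-(a * X * b), ?_⟩
    have : p * p - p = -(p * (1 - p)) := by ring
    rw [this, ← hbh, hh, hp]
    ring
  have hpX : ∀ q r : K[X], aeval A q * aeval A r = aeval A r * aeval A q := fun q r => by
    rw [← map_mul, mul_comm, map_mul]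
  have hAC : aeval A (X : K[X]) * (aeval A p * aeval A (a * X ^ k)) = aeval A p := by
    rw [hpX p, ← mul_assoc, ← map_mul, show X * (a * X ^ k) = p by rw [hp]; ring, hpp]
  have hPC : aeval A p * (aeval A p * aeval A (a * X ^ k)) = aeval A p * aeval A (a * X ^ k) := by
    rw [← mul_assoc, hpp]
  refine ⟨aeval A p, aeval A p * aeval A (a * X ^ k), hpp, ?_, ?_, ?_, hPC, ?_, ?_⟩
  · simpa only [hXA] using hpX X p
  · simpa only [hXA] using hAC
  · rw [← map_mul]
    have := hpX (p * (a * X ^ k)) X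
    rw [hXA] at this
    rw [this, map_mul]
    simpa only [hXA] using hAC
  · rw [mul_assoc, hpX _ p, hPC]
  · intro m hm
    have : aeval A (X ^ m * p) = aeval A (X ^ m : K[X]) := by
      refine hzero _ _ ⟨-(X ^ (m - k) * b), ?_⟩
      have h1 : X ^ m * p - X ^ m = -(X ^ m * (1 - p)) := by ring
      rw [h1, ← hbh, hh]
      obtain ⟨t, rfl⟩ := Nat.exists_eq_add_of_le (hkD.trans hm)
      rw [Nat.add_sub_cancel_left]
      ring
    simpa using this

/-- Any `finrank` consecutive members of the orbit of a vector under an automorphism span the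
whole orbit; the span is mapped onto itself. -/
theorem map_span_orbit_eq {E : Type*} [AddCommGroup E] [Module K E] [FiniteDimensional K E]
    (κ : Module.End K E) (hκ : Function.Injective κ) (x : E) {n : ℕ}
    (hn : Module.finrank K E ≤ n) :
    (Submodule.span K {z | ∃ i < n, (κ ^ i) x = z}).map κ =
      Submodule.span K {z | ∃ i < n, (κ ^ i) x = z} := by
  let L : ℕ → Submodule K E := fun m => Submodule.span K {z | ∃ i < m, (κ ^ i) x = z}
  have hmap : ∀ m, (L m).map κ ≤ L (m + 1) := by
    intro m
    rw [Submodule.map_span_le]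
    rintro _ ⟨i, hi, rfl⟩
    exact Submodule.subset_span ⟨i + 1, by omega, by rw [pow_succ']; rfl⟩
  have hle : L (n + 1) ≤ L n := by
    refine Submodule.le_of_iterate_of_finrank_le L (fun X => X.map κ ⊔ Submodule.span K {x}) ?_ ?_
      (fun m => (Submodule.finrank_le _).trans hn) (n + 1)
    · intro m
      refine le_antisymm (Submodule.span_le.mpr ?_) (sup_le (hmap m) ?_)
      · rintro _ ⟨i, hi, rfl⟩
        rcases i with _ | i
        · exact Submodule.mem_sup_right (Submodule.mem_span_singleton_self x)
        · refine Submodule.mem_sup_left ⟨(κ ^ i) x, Submodule.subset_span ⟨i, by omega, rfl⟩, ?_⟩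
          rw [pow_succ']
          rfl
      · rw [Submodule.span_singleton_le_iff_mem]
        exact Submodule.subset_span ⟨0, by omega, rfl⟩
    · intro m m' hmm
      refine Submodule.span_mono ?_
      rintro _ ⟨i, hi, rfl⟩
      exact ⟨i, hi.trans_le hmm, rfl⟩
  exact Submodule.eq_of_le_of_finrank_eq ((hmap n).trans hle)
    (LinearEquiv.finrank_eq (Submodule.equivMapOfInjective κ hκ (L n))).symm

/-- If the traces of the words of length `L` in two `D × D` matrices `A`, `B` with at least one
`B` only detect whether the word contains exactly one `B`, then `L` is of order at most
`D ^ 3 log D`. -/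
theorem lt_of_forall_trace_word [IsAlgClosed K] {D L : ℕ} (A B : Matrix (Fin D) (Fin D) K)
    (h : ∀ es : List ℕ, es ≠ [] → es.sum + es.length = L →
      ((es.map fun e => A ^ e * B).prod).trace = if es.length = 1 then 1 else 0) :
    L < (4 * D * Nat.log 2 D + 4 * D + 2) * (D ^ 2 + D) + D + 1 := by
  by_contra! hL
  set N := 4 * D * Nat.log 2 D + 4 * D + 2 with hN
  set w := D ^ 2 + D with hw
  obtain ⟨P, C, hPP, hAP, hAC, hCA, hPC, hCP, hAm⟩ := exists_fitting_idempotent A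
  -- `u` agrees with `A` where `A` is invertible, and is the identity on the nilpotent part
  let u : (Matrix (Fin D) (Fin D) K)ˣ :=
    { val := A * P + (1 - P)
      inv := C + (1 - P)
      val_inv := by
        have h1 : A * P * C = P := by rw [mul_assoc, hPC, hAC]
        have h2 : A * P * P = A * P := by rw [mul_assoc, hPP]
        simp only [add_mul, mul_add, mul_sub, sub_mul, mul_one, one_mul, h1, h2, hPC, hPP]
        abel
      inv_val := by
        have h1 : C * (A * P) = P := by rw [← mul_assoc, hCA, hPP]
        have h2 : P * (A * P) = A * P := by rw [← mul_assoc, ← hAP, mul_assoc, hPP]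
        simp only [add_mul, mul_add, mul_sub, sub_mul, mul_one, one_mul, h1, h2, hCP, hPP]
        abel }
  set g := u.val with hg
  set g' := u⁻¹.val with hg'
  have hgg' : g * g' = 1 := u.mul_inv
  have hg'g : g' * g = 1 := u.inv_mul
  have hgval : g = A * P + (1 - P) := rfl
  have hg'val : g' = C + (1 - P) := rfl
  have hcomm : Commute g g' := hgg'.trans hg'g.symm
  have hpow' : ∀ i, g' ^ i * g ^ i = 1 := fun i => by
    rw [← hcomm.symm.mul_pow, hg'g, one_pow]
  have hgP : ∀ i, g ^ i * P = A ^ i * P := by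
    intro i
    induction i with
    | zero => simp
    | succ i ih =>
      have h1 : g * P = P * A := by
        rw [hgval, add_mul, sub_mul, mul_assoc, hPP, one_mul, sub_self, add_zero, hAP]
      rw [pow_succ, mul_assoc, h1, ← mul_assoc, ih, mul_assoc, ← hAP, ← mul_assoc, pow_succ]
  have hCgP : ∀ δ, D ≤ δ → C * g ^ (δ + 1) * P = A ^ δ := by
    intro δ hδ
    rw [mul_assoc, hgP, pow_succ', ← mul_assoc, ← mul_assoc, hCA, mul_assoc, hAm δ hδ,
      ← (Commute.pow_left hAP δ).eq, hAm δ hδ]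
  -- conjugation by `g`, and the space spanned by the conjugates of the basic letter
  let κ : Module.End K (Matrix (Fin D) (Fin D) K) :=
    LinearMap.mulRight K g' ∘ₗ LinearMap.mulLeft K g
  have hκ : ∀ i y, (κ ^ i) y = g ^ i * y * g' ^ i := by
    intro i y
    induction i with
    | zero => simp
    | succ i ih =>
      rw [pow_succ', Module.End.mul_apply, ih]
      change g * (g ^ i * y * g' ^ i) * g' = _
      rw [pow_succ' g, pow_succ g']
      simp only [mul_assoc]
  have hκinj : Function.Injective κ := by
    intro y z hyz
    change g * y * g' = g * z * g' at hyz
    have := congrArg (fun t => g' * t * g) hyz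
    simpa only [mul_assoc, hg'g, mul_one, ← mul_assoc g' g, one_mul] using this
  let Y := Submodule.span K {z | ∃ i < D ^ 2, (κ ^ i) (P * B * C) = z}
  have hYmap : ∀ a, Y.map (κ ^ a) = Y := by
    intro a
    induction a with
    | zero => exact Submodule.map_id Y
    | succ a ih =>
      rw [pow_succ', Module.End.mul_eq_comp, Submodule.map_comp, ih]
      exact map_span_orbit_eq κ hκinj _ (by
        rw [Module.finrank_matrix, Fintype.card_fin, Module.finrank_self, mul_one, pow_two])
  have hwin : ∀ a, Y ≤ Submodule.span K {z | ∃ i, a ≤ i ∧ i < a + D ^ 2 ∧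
      g ^ i * (P * B * C) * g' ^ i = z} := by
    intro a
    rw [← hYmap a, Submodule.map_span_le]
    rintro _ ⟨i, hi, rfl⟩
    refine Submodule.subset_span ⟨a + i, by omega, by omega, ?_⟩
    rw [← Module.End.mul_apply, ← pow_add, hκ]
  -- products of letters, taken from windows far enough apart, are words in `A` and `B`
  let W : ℕ → ℕ → Set (Matrix (Fin D) (Fin D) K) := fun k a => {z | ∃ (i j : ℕ) (es : List ℕ),
    es.length = k ∧ a ≤ i ∧ j < a + (k + 1) * w ∧ i + (es.sum + es.length) = j ∧
    g ^ i * (P * B * (es.map fun e => A ^ e * B).prod * C) * g' ^ j = z}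
  have hword : ∀ k a, Y ^ (k + 1) ≤ Submodule.span K (W k a) := by
    intro k
    induction k with
    | zero =>
      intro a
      rw [zero_add, pow_one]
      refine (hwin a).trans (Submodule.span_mono ?_)
      rintro _ ⟨i, hai, hia, rfl⟩
      exact ⟨i, i, [], rfl, hai, by omega, by simp, by simp⟩
    | succ k ih =>
      intro a
      rw [pow_succ']
      refine (mul_le_mul' (hwin a) (ih (a + w))).trans ?_
      rw [Submodule.span_mul_span, Submodule.span_le]
      rintro _ ⟨_, ⟨i₀, hai₀, hi₀, rfl⟩, _, ⟨i, j, es, hes, hai, hj, hij, rfl⟩, rfl⟩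
      obtain ⟨δ, rfl⟩ : ∃ δ, i = i₀ + (δ + 1) := ⟨i - i₀ - 1, by omega⟩
      refine Submodule.subset_span ⟨i₀, j, δ :: es, by simp [hes], hai₀, ?_, ?_, ?_⟩
      · calc j < a + w + (k + 1) * w := hj
          _ = a + (k + 1 + 1) * w := by ring
      · simp only [List.sum_cons, List.length_cons]
        omega
      · simp only [List.map_cons, List.prod_cons]
        rw [← hCgP δ (by omega)]
        calc _ = g ^ i₀ * (P * B * (C * (1 * g ^ (δ + 1)) * P * B *
              (es.map fun e => A ^ e * B).prod) * C) * g' ^ j := by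
              simp only [mul_assoc, one_mul]
          _ = _ := by
              rw [← hpow' i₀, mul_assoc (g' ^ i₀), ← pow_add]
              simp only [mul_assoc]
  -- against `g ^ L` the conjugations cancel cyclically, leaving the trace of a word of length `L`
  -- with `k + 1` letters `B`
  have htrace : ∀ k z, z ∈ W k 0 → (k + 1) * w + D + 1 ≤ L →
      (g ^ L * z).trace = if k = 0 then 1 else 0 := by
    rintro k _ ⟨i, j, es, hes, -, hj, hij, rfl⟩ hkL
    rw [zero_add] at hj
    have hm : ∃ m, D ≤ m ∧ L + i = m + 1 + j := ⟨L + i - j - 1, by omega, by omega⟩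
    obtain ⟨m, hDm, hm⟩ := hm
    have hword := h (m :: es) (by simp) (by
      simp only [List.sum_cons, List.length_cons]
      omega)
    rw [List.map_cons, List.prod_cons, List.length_cons, hes] at hword
    simp only [Nat.add_eq_right] at hword
    rw [← hword]
    set M := (es.map fun e => A ^ e * B).prod
    calc (g ^ L * (g ^ i * (P * B * M * C) * g' ^ j)).trace
        = ((g ^ (m + 1 + j) * (P * B * M)) * (C * g' ^ j)).trace := by
          rw [← hm, pow_add]; simp only [mul_assoc]
      _ = (C * (g' ^ j * g ^ (j + (m + 1))) * (P * B * M)).trace := by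
          rw [Matrix.trace_mul_comm, add_comm j]; simp only [mul_assoc]
      _ = (C * g ^ (m + 1) * P * B * M).trace := by
          rw [pow_add, ← mul_assoc (g' ^ j), hpow', one_mul]; simp only [mul_assoc]
      _ = (A ^ m * B * M).trace := by rw [hCgP m hDm]
  have hYW : ∀ k, (k + 1) * w + D + 1 ≤ L → ∀ z ∈ Y ^ (k + 1),
      1 ≤ k → (g ^ L * z).trace = 0 := by
    intro k hk z hz hk1
    have hle : Submodule.span K (W k 0) ≤ LinearMap.ker (Matrix.traceLinearMap (Fin D) K K ∘ₗ
        LinearMap.mulLeft K (g ^ L)) := by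
      rw [Submodule.span_le]
      intro z hz
      have := htrace k z hz hk
      rwa [if_neg (by omega)] at this
    exact hle (hword k 0 hz)
  -- the traces vanish on all products of `2` to `N` letters, hence on the letters themselves, but
  -- the word with a single `B` has trace `1`
  have hN2 : 2 * w + D + 1 ≤ L := by nlinarith
  have hu : (u ^ L).val = g ^ L := Units.val_pow_eq_pow_val u L
  have hu' : (u ^ L)⁻¹.val = g' ^ L := by rw [← inv_pow, Units.val_pow_eq_pow_val]
  have hzero := trace_mul_eq_zero_of_forall_pow (Y := Y) (N := N) (u ^ L)
    (fun y hy => by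
      rw [← hYmap L] at hy
      obtain ⟨y, hy, rfl⟩ := hy
      rw [hu, hu', hκ, show g' ^ L * (g ^ L * y * g' ^ L) * g ^ L =
        (g' ^ L * g ^ L) * y * (g' ^ L * g ^ L) by simp only [mul_assoc], hpow', one_mul, mul_one]
      exact hy)
    (fun y hy => by
      rw [hu, hu', ← hκ, ← hYmap L]
      exact ⟨y, hy, rfl⟩) le_rfl
    (fun k h2 hkN z hz => by
      obtain ⟨k, rfl⟩ := Nat.exists_eq_add_of_le' h2
      rw [hu]
      refine hYW (k + 1) ?_ z hz (by omega)
      calc (k + 1 + 1) * w + D + 1 ≤ N * w + D + 1 := by gcongr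
        _ ≤ L := hL)
  have hD : 0 < D := by
    by_contra hD0
    obtain rfl : D = 0 := by omega
    have := h [L - 1] (by simp) (by simp; omega)
    simp at this
  have hone : (g ^ L * (P * B * C)).trace = 1 :=
    htrace 0 _ ⟨0, 0, [], rfl, le_rfl, by rw [zero_add, zero_add, one_mul]; omega, by simp, by simp⟩
      (by omega)
  have hmem : P * B * C ∈ Y := Submodule.subset_span ⟨0, by positivity, by simp⟩
  have := hzero _ hmem
  rw [hu, hone] at this
  exact one_ne_zero this

end Words

/-! ### Tensor network states as traces -/

section Trace

theorem list_ofFn_prod_apply {R ι : Type*} [CommSemiring R] [Fintype ι] [DecidableEq ι] {n : ℕ}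
    (N : Fin (n + 1) → Matrix ι ι R) (a b : ι) :
    (List.ofFn N).prod a b = ∑ y : Fin n → ι, ∏ k, N k ((Fin.cons a y : Fin (n + 1) → ι) k)
      ((Fin.snoc y b : Fin (n + 1) → ι) k) := by
  induction n generalizing a with
  | zero => simp [Fin.snoc]
  | succ n ih =>
    rw [List.ofFn_succ, List.prod_cons, Matrix.mul_apply,
      ← (Fin.consEquiv fun _ : Fin (n + 1) => ι).sum_comp, Fintype.sum_prod_type]
    refine Finset.sum_congr rfl fun c _ => ?_
    rw [ih, Finset.mul_sum]
    refine Finset.sum_congr rfl fun y _ => ?_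
    change _ = ∏ k, N k ((Fin.cons a (Fin.cons c y : Fin (n + 1) → ι) : Fin (n + 2) → ι) k)
      ((Fin.snoc (Fin.cons c y : Fin (n + 1) → ι) b : Fin (n + 2) → ι) k)
    rw [← Fin.cons_snoc_eq_snoc_cons, Fin.prod_univ_succ (n := n + 1)]
    simp only [Fin.cons_zero, Fin.cons_succ]

theorem trace_list_ofFn_prod {R ι : Type*} [CommSemiring R] [Fintype ι] [DecidableEq ι] {n : ℕ}
    (N : Fin (n + 1) → Matrix ι ι R) :
    (List.ofFn N).prod.trace =
      ∑ x : Fin (n + 1) → ι, ∏ k, N k (x k) (x (finRotate (n + 1) k)) := by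
  rw [← (Fin.consEquiv fun _ : Fin (n + 1) => ι).sum_comp, Fintype.sum_prod_type, Matrix.trace]
  refine Finset.sum_congr rfl fun a _ => ?_
  rw [Matrix.diag_apply, list_ofFn_prod_apply]
  refine Finset.sum_congr rfl fun y _ => Finset.prod_congr rfl fun k _ => ?_
  rw [Fin.snoc_eq_cons_rotate]
  rfl

/-- The coefficients of a translation-invariant tensor network state on the cycle are traces of
products of matrices. -/
theorem tiState_apply_eq_trace {d D L : ℕ} (hL : 1 ≤ L)
    (A : Matrix (Fin d) (Fin D × Fin D) ℂ) (i : Fin L → Fin d) :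
    TIMPS.tiState L A i =
      (List.ofFn fun k => Matrix.of fun b c => A (i k) (b, c)).prod.trace := by
  obtain ⟨n, rfl⟩ := Nat.exists_eq_add_of_le' hL
  rw [trace_list_ofFn_prod]
  unfold TIMPS.tiState TIMPS.applyLocal TIMPS.cycleState
  rw [← (Equiv.arrowProdEquivProdArrow (Fin (n + 1)) (fun _ => Fin D)
    (fun _ => Fin D)).symm.sum_comp,
    Fintype.sum_prod_type]
  refine Finset.sum_congr rfl fun x _ => ?_
  have h : ∀ y : Fin (n + 1) → Fin D,
      (∏ k, if y k = x (finRotate (n + 1) k) then (1 : ℂ) else 0) =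
        if y = fun k => x (finRotate (n + 1) k) then 1 else 0 := by
    intro y
    rw [Finset.prod_ite_zero]
    simp [funext_iff]
  refine (Finset.sum_congr rfl fun y _ =>
    congrArg (fun t => (∏ k, A (i k) (x k, y k)) * t) (h y)).trans ?_
  simp only [mul_ite, mul_one, mul_zero, Finset.sum_ite_eq', Finset.mem_univ,
    if_true, Matrix.of_apply]

theorem tiState_smul {d D L : ℕ} (c : ℂ) (A : Matrix (Fin d) (Fin D × Fin D) ℂ) :
    TIMPS.tiState L (c • A) = c ^ L • TIMPS.tiState L A := by
  funext i
  simp only [TIMPS.tiState, TIMPS.applyLocal, Pi.smul_apply, smul_eq_mul, Finset.mul_sum,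
    Matrix.smul_apply, Finset.prod_mul_distrib, Finset.prod_const, Finset.card_univ,
    Fintype.card_fin, mul_assoc]

theorem smul_tiState_mem_tiTNS {d D L : ℕ} (hL : 1 ≤ L) (c : ℂ)
    (A : Matrix (Fin d) (Fin D × Fin D) ℂ) : c • TIMPS.tiState L A ∈ TIMPS.tiTNS L D d := by
  -- the scalar is absorbed into the local map by an `L`-th root
  obtain ⟨z, hz⟩ := IsAlgClosed.exists_pow_nat_eq c (show 0 < L by omega)
  exact ⟨z • A, by rw [← hz]; exact tiState_smul z A⟩

/-- The local map whose matrices, one for each basis vector `x` of the physical space, are diagonal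
with entries `v x`. -/
def diagonalTensor {R : Type*} [Zero R] {d D : ℕ} (v : Fin d → Fin D → R) :
    Matrix (Fin d) (Fin D × Fin D) R :=
  Matrix.of fun x p => if p.1 = p.2 then v x p.1 else 0

theorem tiState_diagonalTensor {d D L : ℕ} (hL : 1 ≤ L) (v : Fin d → Fin D → ℂ)
    (i : Fin L → Fin d) : TIMPS.tiState L (diagonalTensor v) i = ∑ b, ∏ k, v (i k) b := by
  rw [tiState_apply_eq_trace hL]
  have h : (List.ofFn fun k => Matrix.of fun b c => diagonalTensor v (i k) (b, c)) =
      (List.ofFn fun k => v (i k)).map (Matrix.diagonalRingHom (Fin D) ℂ) := by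
    rw [List.map_ofFn]
    congr 1
  rw [h, ← map_list_prod, List.prod_ofFn, Matrix.diagonalRingHom_apply, Matrix.trace_diagonal]
  simp only [Finset.prod_apply]

end Trace

/-! ### Upper bounds -/

section UpperBounds

/-- Diagonal tensors built from `M`-th roots of unity detect whether the weight is `a` modulo `M`,
by orthogonality of characters. The exponent `(M - 1) * a` stands for `-a` modulo `M`. -/
theorem exists_tiState_eq_pow_mul_ite (a L M : ℕ) (hL : 1 ≤ L) (hM : 1 ≤ M) :
    ∃ v : Fin (a + 1) → Fin M → ℂ, ∀ (ε : ℂ) (i : Fin L → Fin (a + 1)),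
      TIMPS.tiState L (diagonalTensor fun x b => ε ^ (x : ℕ) * v x b) i =
        if M ∣ (∑ k, (i k : ℕ)) + (M - 1) * a then ε ^ ∑ k, (i k : ℕ) else 0 := by
  have hζ := Complex.isPrimitiveRoot_exp M (by omega)
  set ζ := Complex.exp (2 * Real.pi * Complex.I / M)
  have hMC : (M : ℂ) ≠ 0 := by exact_mod_cast (show M ≠ 0 by omega)
  have hω : ∀ b : Fin M, ∃ w : ℂ, w ^ L = (M : ℂ)⁻¹ * (ζ ^ ((M - 1) * a)) ^ (b : ℕ) := fun b =>
    IsAlgClosed.exists_pow_nat_eq _ (by omega)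
  -- the factors `w b`, one for each site, multiply to the coefficient of the character `b` in the
  -- indicator of the weight `a` modulo `M`
  choose w hw using hω
  refine ⟨fun x b => w b * (ζ ^ (b : ℕ)) ^ (x : ℕ), fun ε i => ?_⟩
  rw [tiState_diagonalTensor hL]
  set s := ∑ k, (i k : ℕ) with hs
  have hterm : ∀ b : Fin M, ∏ k, ε ^ (i k : ℕ) * (w b * (ζ ^ (b : ℕ)) ^ (i k : ℕ)) =
      ε ^ s * (M : ℂ)⁻¹ * (ζ ^ (s + (M - 1) * a)) ^ (b : ℕ) := by
    intro b
    rw [Finset.prod_mul_distrib, Finset.prod_mul_distrib, Finset.prod_pow_eq_pow_sum,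
      Finset.prod_pow_eq_pow_sum, Finset.prod_const, Finset.card_univ, Fintype.card_fin, hw, ← hs,
      pow_add, mul_pow, pow_right_comm ζ]
    ring
  simp only [hterm]
  rw [← Finset.mul_sum, Fin.sum_univ_eq_sum_range (fun b => (ζ ^ (s + (M - 1) * a)) ^ b)]
  by_cases hdvd : M ∣ s + (M - 1) * a
  · rw [if_pos hdvd, (hζ.pow_eq_one_iff_dvd _).mpr hdvd]
    simp [hMC]
  · rw [if_neg hdvd]
    have hne : ζ ^ (s + (M - 1) * a) - 1 ≠ 0 := fun h =>
      hdvd ((hζ.pow_eq_one_iff_dvd _).mp (sub_eq_zero.mp h))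
    have h0 : (ζ ^ (s + (M - 1) * a)) ^ M = 1 := by
      rw [← pow_mul, mul_comm, pow_mul, hζ.pow_eq_one, one_pow]
    have := mul_geom_sum (ζ ^ (s + (M - 1) * a)) M
    rw [h0, sub_self] at this
    rw [(mul_eq_zero.mp this).resolve_left hne, mul_zero]

theorem dvd_add_pred_mul_iff {M s a : ℕ} (hM : 1 ≤ M) :
    M ∣ s + (M - 1) * a ↔ (M : ℤ) ∣ (s : ℤ) - a := by
  obtain ⟨m, rfl⟩ := Nat.exists_eq_add_of_le' hM
  rw [← Int.natCast_dvd_natCast, Nat.add_sub_cancel]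
  push_cast
  rw [show (s : ℤ) + m * a = (s - a) + (m + 1) * a by ring,
    dvd_add_left (Dvd.intro _ rfl)]

/-- No weight of a basis state exceeds `a * L`, so weight `a` modulo `(a + 1) * L` means weight
`a`. -/
theorem weightState_mem_tiTNS (a L : ℕ) (hL : 1 ≤ L) :
    TIMPS.weightState a L ∈ TIMPS.tiTNS L ((a + 1) * L) (a + 1) := by
  have hM : 1 ≤ (a + 1) * L := Nat.mul_pos (Nat.succ_pos a) hL
  obtain ⟨v, hv⟩ := exists_tiState_eq_pow_mul_ite a L ((a + 1) * L) hL hM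
  refine ⟨_, funext fun i => (hv 1 i).trans ?_⟩
  rw [one_pow, TIMPS.weightState, TIMPS.weightStateDim]
  have hs : ∑ k, (i k : ℕ) ≤ a * L := by
    calc ∑ k, (i k : ℕ) ≤ ∑ _k : Fin L, a := Finset.sum_le_sum fun k _ => Nat.lt_succ_iff.mp (i k).2
      _ = a * L := by simp [mul_comm]
  congr 1
  rw [eq_iff_iff, dvd_add_pred_mul_iff hM]
  constructor
  · intro h
    have h1 : ((∑ k, (i k : ℕ) : ℕ) : ℤ) - a = 0 := by
      have h0 : a * L < (a + 1) * L := Nat.mul_lt_mul_of_pos_right (Nat.lt_succ_self a) hL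
      have h2 : a < (a + 1) * L := (Nat.lt_succ_self a).trans_le (Nat.le_mul_of_pos_right _ hL)
      exact Int.eq_zero_of_abs_lt_dvd h (abs_lt.mpr ⟨by omega, by omega⟩)
    omega
  · intro h
    rw [h, sub_self]
    exact dvd_zero _

/-- Among the weights congruent to `a` modulo `a + 1`, none is smaller than `a`, and those larger
than `a` disappear in the limit, having a larger power of `ε`. -/
theorem hasTIBorderRepresentation_weightState (a L : ℕ) (hL : 1 ≤ L) :
    TIMPS.HasTIBorderRepresentation (a + 1) (TIMPS.weightState a L) := by
  obtain ⟨v, hv⟩ := exists_tiState_eq_pow_mul_ite a L (a + 1) hL (Nat.succ_pos a)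
  refine ⟨diagonalTensor fun x b => X ^ (x : ℕ) * C (v x b), a, ?_⟩
  have hA : ∀ ε : ℂ, (diagonalTensor fun (x : Fin (a + 1)) b => X ^ (x : ℕ) * C (v x b)).map
      (Polynomial.eval ε) = diagonalTensor fun x b => ε ^ (x : ℕ) * v x b := by
    intro ε
    ext x p
    rw [Matrix.map_apply, diagonalTensor, diagonalTensor, Matrix.of_apply, Matrix.of_apply]
    split_ifs <;> simp only [eval_mul, eval_pow, eval_X, eval_C, eval_zero]
  rw [tendsto_pi_nhds]
  intro i
  simp only [hA, Pi.smul_apply, hv, smul_eq_mul, TIMPS.weightState, TIMPS.weightStateDim]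
  set s := ∑ k, (i k : ℕ) with hs
  have hne : ∀ᶠ ε : ℂ in 𝓝[≠] 0, ε ≠ 0 := eventually_mem_nhdsWithin
  rcases lt_trichotomy s a with hsa | hsa | hsa
  · have hnd : ¬ (a + 1) ∣ s + (a + 1 - 1) * a := by
      rw [dvd_add_pred_mul_iff (Nat.succ_pos a)]
      intro h
      have : ((s : ℤ) - a) = 0 := by
        refine Int.eq_zero_of_abs_lt_dvd h (abs_lt.mpr ⟨?_, ?_⟩) <;> push_cast <;> omega
      omega
    simp only [if_neg hsa.ne, if_neg hnd, mul_zero, tendsto_const_nhds]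
  · have hdvd : (a + 1) ∣ s + (a + 1 - 1) * a := by
      rw [dvd_add_pred_mul_iff (Nat.succ_pos a), hsa, sub_self]
      exact dvd_zero _
    simp only [if_pos hsa, if_pos hdvd]
    refine (tendsto_congr' ?_).mpr tendsto_const_nhds
    filter_upwards [hne] with ε hε
    rw [hsa, inv_mul_cancel₀ (pow_ne_zero a hε)]
  · rw [if_neg hsa.ne']
    split_ifs with hdvd
    · have h1 : Tendsto (fun ε : ℂ => ε ^ (s - a)) (𝓝[≠] 0) (𝓝 0) := by
        have := ((continuous_pow (M := ℂ) (s - a)).tendsto 0).mono_left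
          (nhdsWithin_le_nhds (s := {0}ᶜ))
        rwa [zero_pow (by omega)] at this
      refine (tendsto_congr' ?_).mpr h1
      filter_upwards [hne] with ε hε
      rw [inv_mul_eq_iff_eq_mul₀ (pow_ne_zero a hε), ← pow_add, Nat.add_sub_cancel' hsa.le]
    · simp

theorem tiBorderBond_le_of_hasTIBorderRepresentation {L d D : ℕ} (hL : 1 ≤ L)
    {ψ : TIMPS.State L (Fin d)} (h : TIMPS.HasTIBorderRepresentation D ψ) :
    TIMPS.tiBorderBond ψ ≤ (D : ℕ∞) := by
  obtain ⟨A, e, hA⟩ := h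
  have hmem : ψ ∈ closure (TIMPS.tiTNS L D d) := mem_closure_of_tendsto hA
    (Eventually.of_forall fun ε => smul_tiState_mem_tiTNS hL _ _)
  exact iInf₂_le_of_le D hmem le_rfl

end UpperBounds

/-! ### Lower bound -/

section LowerBound

/-- Restricted to the basis vectors `0` and `a`, the weight state gives coefficient `1` to the words
with a single `a`, and `0` to those with several. -/
theorem lt_of_weightState_mem_tiTNS {a L D : ℕ} (ha : 1 ≤ a) (hL : 1 ≤ L)
    (h : TIMPS.weightState a L ∈ TIMPS.tiTNS L D (a + 1)) :
    L < (4 * D * Nat.log 2 D + 4 * D + 2) * (D ^ 2 + D) + D + 1 := by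
  obtain ⟨A, hA⟩ := h
  let M : Fin (a + 1) → Matrix (Fin D) (Fin D) ℂ := fun x => Matrix.of fun b c => A x (b, c)
  refine lt_of_forall_trace_word (M 0) (M (Fin.last a)) fun es hes hlen => ?_
  let w : List (Fin (a + 1)) := es.flatMap fun e => List.replicate e 0 ++ [Fin.last a]
  have hwlen : w.length = L := by
    rw [← hlen]
    clear hes hlen
    induction es with
    | nil => rfl
    | cons e es ih => simp_all [w]; omega
  have hwsum : (w.map fun x : Fin (a + 1) => (x : ℕ)).sum = es.length * a := by
    clear hes hlen hwlen
    induction es with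
    | nil => simp [w]
    | cons e es ih =>
      simp only [w, List.flatMap_cons, List.map_append, List.sum_append, ih, List.map_replicate,
        List.sum_replicate, List.map_cons, List.map_nil, List.sum_cons, List.sum_nil,
        List.length_cons, Fin.val_zero, Fin.val_last]
      ring
  have hwprod : (w.map M).prod = (es.map fun e => M 0 ^ e * M (Fin.last a)).prod := by
    clear hes hlen hwlen hwsum
    induction es with
    | nil => rfl
    | cons e es ih => simp_all [w, mul_assoc]
  subst hwlen
  have h1 := congrFun hA w.get
  simp only at h1
  rw [tiState_apply_eq_trace hL, TIMPS.weightState, TIMPS.weightStateDim] at h1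
  have h2 : (List.ofFn fun k => Matrix.of fun b c => A (w.get k) (b, c)) = w.map M := by
    have := List.map_ofFn (f := w.get) (g := M)
    rw [List.ofFn_get] at this
    exact this.symm
  have h3 : ∑ k, (w.get k : ℕ) = (w.map fun x : Fin (a + 1) => (x : ℕ)).sum := by
    rw [← List.sum_ofFn]
    have := List.map_ofFn (f := w.get) (g := fun x : Fin (a + 1) => (x : ℕ))
    rw [List.ofFn_get] at this
    rw [this]
    rfl
  rw [h2, hwprod, h3, hwsum] at h1
  rw [h1]
  congr 1
  rw [eq_iff_iff]
  constructor
  · intro h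
    exact Nat.eq_of_mul_eq_mul_right (by omega : 0 < a) (by rw [h, one_mul])
  · intro h
    rw [h, one_mul]

/-- The upper bound on `L` in terms of `D`, solved for `D`; the logarithm of `D` is replaced by that
of `L`, which only matters, and is allowed, for `D < L`. -/
theorem rpow_div_log_le_of_lt {L D : ℕ} (hL : 2 ≤ L)
    (h : L < (4 * D * Nat.log 2 D + 4 * D + 2) * (D ^ 2 + D) + D + 1) :
    (1 / 10 : ℝ) * ((L : ℝ) ^ ((1 : ℝ) / 3) / Real.log (L : ℝ)) ≤ (D : ℝ) := by
  have hD : 1 ≤ D := by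
    by_contra h0
    obtain rfl : D = 0 := by omega
    omega
  have hL2 : (2 : ℝ) ≤ L := by exact_mod_cast hL
  have hlog2 : (1 / 2 : ℝ) < Real.log 2 := by linarith [Real.log_two_gt_d9]
  have hlogL : Real.log 2 ≤ Real.log L := Real.log_le_log (by norm_num) hL2
  have hpos : 0 < Real.log L := by linarith
  have hD1 : (1 : ℝ) ≤ D := by exact_mod_cast hD
  rw [← mul_div_assoc, div_le_iff₀ hpos]
  rcases le_or_gt L D with hLD | hLD
  · have h1 : (L : ℝ) ^ ((1 : ℝ) / 3) ≤ L := by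
      conv_rhs => rw [← Real.rpow_one (L : ℝ)]
      exact Real.rpow_le_rpow_of_exponent_le (by linarith) (by norm_num)
    have h2 : (L : ℝ) ≤ D := by exact_mod_cast hLD
    nlinarith
  · have hN : L ≤ 14 * D ^ 3 * (Nat.log 2 D + 1) := by
      obtain ⟨m, rfl⟩ := Nat.exists_eq_add_of_le' hD
      have h1 : (4 * (m + 1) * Nat.log 2 (m + 1) + 4 * (m + 1) + 2) ≤
          6 * (m + 1) * (Nat.log 2 (m + 1) + 1) := by nlinarith [Nat.zero_le (Nat.log 2 (m + 1))]
      have h2 : (m + 1) ^ 2 + (m + 1) ≤ 2 * (m + 1) ^ 2 := by nlinarith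
      have h3 : m + 1 ≤ 2 * (m + 1) ^ 3 * (Nat.log 2 (m + 1) + 1) := by
        calc m + 1 = 1 * (m + 1) ^ 1 * 1 := by ring
          _ ≤ _ := by gcongr <;> omega
      have h4 := Nat.mul_le_mul h1 h2
      nlinarith
    have hlogD : (Nat.log 2 D : ℝ) ≤ 2 * Real.log L := by
      have h1 : (Nat.log 2 D : ℝ) ≤ Real.logb 2 D := by exact_mod_cast Real.natLog_le_logb D 2
      have h2 : Real.log D ≤ Real.log L :=
        Real.log_le_log (by linarith) (by exact_mod_cast hLD.le)
      rw [Real.logb, le_div_iff₀ (by linarith)] at h1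
      nlinarith [Nat.cast_nonneg (α := ℝ) (Nat.log 2 D)]
    have hLR : (L : ℝ) ≤ 14 * (D : ℝ) ^ 3 * (Nat.log 2 D + 1) := by exact_mod_cast hN
    have hcube : (L : ℝ) ≤ (10 * (D * Real.log L)) ^ 3 := by
      have h1 : (Nat.log 2 D : ℝ) + 1 ≤ 4 * Real.log L := by linarith
      have h2 : (1 / 4 : ℝ) ≤ Real.log L ^ 2 := by nlinarith
      calc (L : ℝ) ≤ 14 * (D : ℝ) ^ 3 * (4 * Real.log L) := hLR.trans (by gcongr)
        _ = 56 * ((D : ℝ) ^ 3 * Real.log L) := by ring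
        _ ≤ (1000 * Real.log L ^ 2) * ((D : ℝ) ^ 3 * Real.log L) := by
          gcongr
          linarith
        _ = _ := by ring
    have h1 : (L : ℝ) ^ ((1 : ℝ) / 3) ≤ 10 * (D * Real.log L) := by
      calc (L : ℝ) ^ ((1 : ℝ) / 3) ≤ ((10 * (D * Real.log L)) ^ 3) ^ ((1 : ℝ) / 3) :=
            Real.rpow_le_rpow (by linarith) hcube (by norm_num)
        _ = 10 * (D * Real.log L) := by
          rw [one_div]
          exact_mod_cast Real.pow_rpow_inv_natCast (n := 3) (by positivity) (by norm_num)
    linarith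

end LowerBound

theorem mainTheorem4 :
    (∀ a L : ℕ, 1 ≤ L →
      TIMPS.tiBond (TIMPS.weightState a L) ≤ (((a + 1) * L : ℕ) : ℕ∞) ∧
      TIMPS.tiBorderBond (TIMPS.weightState a L) ≤ ((a + 1 : ℕ) : ℕ∞) ∧
      TIMPS.HasTIBorderRepresentation (a + 1) (TIMPS.weightState a L)) ∧
    ∃ c : ℝ, 0 < c ∧ ∀ a L : ℕ, 1 ≤ a → 2 ≤ L → ∀ D : ℕ,
      TIMPS.tiBond (TIMPS.weightState a L) = (D : ℕ∞) →
        c * ((L : ℝ) ^ ((1 : ℝ) / 3) / Real.log (L : ℝ)) ≤ (D : ℝ) := by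
  refine ⟨fun a L hL => ?_, 1 / 10, by norm_num, fun a L ha hL D hD => ?_⟩
  · have hrep := hasTIBorderRepresentation_weightState a L hL
    exact ⟨iInf₂_le_of_le _ (weightState_mem_tiTNS a L hL) le_rfl,
      tiBorderBond_le_of_hasTIBorderRepresentation hL hrep, hrep⟩
  · have hlt : TIMPS.tiBond (TIMPS.weightState a L) < ((D + 1 : ℕ) : ℕ∞) := by
      rw [hD]
      exact_mod_cast Nat.lt_succ_self D
    obtain ⟨D', hD'⟩ := iInf_lt_iff.mp hlt
    obtain ⟨hmem, hD'⟩ := iInf_lt_iff.mp hD'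
    have hle : D' ≤ D := Nat.lt_succ_iff.mp (by exact_mod_cast hD')
    have h := rpow_div_log_le_of_lt hL (lt_of_weightState_mem_tiTNS ha (by omega) hmem)
    exact h.trans (by exact_mod_cast hle)
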